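/- Let $\mathfrak H$ be a complex Hilbert space, let $S$ be a densely defined nonnegative symmetric operator in $\mathfrak H$, and let $\widetilde S_0,\widetilde S_1$ be nonnegative selfadjoint extensions of $S$ with $\operatorname{dom}\widetilde S_1\cap\operatorname{dom}\widetilde S_0=\operatorname{dom}S$. For a nonnegative selfadjoint linear relation $H$ (in particular an operator), let $H[\cdot,\cdot]$ denote the corresponding closed nonnegative form, with domain $\mathcal D[H]$, so that $\operatorname{dom}H\subset\mathcal D[H]$ and $H[f,k]=(f',k)$ for $\{f,f'\}\in H$, $k\in\mathcal D[H]$; write $H[v]=H[v,v]$. Assume that $\widetilde S_0[\cdot,\cdot]$ is a closed restriction of $\widetilde S_1[\cdot,\cdot]$. Equip $\mathcal D[\widetilde S_1]$ with the inner product $\widetilde S_1[f,g]+(f,g)$, let $\mathcal D[\widetilde S_1]\ominus\mathcal D[\widetilde S_0]$ be the orthogonal complement with respect to it, and put $$\mathcal L=\operatorname{dom}\widetilde S_0\dotplus\bigl(\mathcal D[\widetilde S_1]\ominus\mathcal D[\widetilde S_0]\bigr).$$ Let $\{\mathcal H,\Gamma_0,\Gamma_1\}$ be a boundary triplet for $\{\widetilde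 S_0,\widetilde S_1\}$, that is: $\mathcal H$ is a Hilbert space, $\Gamma_0$ is a continuous linear operator from $\mathcal D[\widetilde S_1]$ onto $\mathcal H$ with $\ker\Gamma_0=\mathcal D[\widetilde S_0]$, and $\Gamma_1:\mathcal L\to\mathcal H$ is the linear operator with $$\widetilde S_1[u,v]=(S^*u,v)-(\Gamma_1u,\Gamma_0v)_{\mathcal H}\qquad(u\in\mathcal L,\ v\in\mathcal D[\widetilde S_1]).$$ Then $\mathcal L\subset\mathcal D[\widetilde S_1]\cap\operatorname{dom}S^*$, and the operator $\widetilde{\mathcal A}$ in $\mathfrak H\oplus\mathcal H$ with domain $\{(u,\Gamma_0u):u\in\mathcal L\}$ and $$\widetilde{\mathcal A}(u,\Gamma_0u)=(S^*u,-\Gamma_1u),\qquad u\in\mathcal L,$$ is a nonnegative selfadjoint extension of $S$ (where $\mathfrak H$ is identified with $\mathfrak H\oplus\{0\}$). Moreover, $$\mathcal D[\widetilde{\mathcal A}]=\{(v,\Gamma_0v):v\in\mathcal D[\widetilde S_1]\},\qquad \widetilde{\mathcal A}[(u,\Gamma_0u),(v,\Gamma_0v)]=\widetilde S_1[u,v]\quad(u,v\in\mathcal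 D[\widetilde S_1]),$$ and $\operatorname{dom}\widetilde{\mathcal A}^{1/2}\cap\mathcal H=\{0\}$ (where $\mathcal H$ is identified with $\{0\}\oplus\mathcal H$). If, in addition, $\widetilde S_0\cap\widetilde S_1=S$ (as graphs), $\widetilde S_0[\cdot,\cdot]$ is a closed restriction of $\widetilde S_1[\cdot,\cdot]$, and $\widetilde S_1^{-1}[\cdot,\cdot]$ is a closed restriction of $\widetilde S_0^{-1}[\cdot,\cdot]$ (the inverses being linear relations), then $$\inf_{u\in\operatorname{dom}\widetilde S_0}\widetilde{\mathcal A}\bigl[(v,\Gamma_0v)-(u,0)\bigr]=0\qquad\text{for all }v\in\mathcal D[\widetilde S_1],$$ and $\operatorname{ran}\widetilde{\mathcal A}^{1/2}\cap\mathcal H=\{0\}$. -/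

import Mathlib

open scoped LinearPMap ComplexOrder
open Filter Topology

noncomputable section

namespace NonnegExt

/-! Throughout, `inner ℂ x y` is conjugate-linear in `x` and linear in `y`, so the inner product
`(x, y)` that is linear in its first argument is `inner ℂ y x`.  A linear relation in `E` is a
subspace of `E × E`; an operator is identified with its graph. -/

section Forms

variable {E : Type*} [NormedAddCommGroup E] [InnerProductSpace ℂ E]

variable (E) in
/-- A sesquilinear form in `E`, defined on a subspace; `h.form u v` is `h[u, v]`, linear in `u`
and conjugate-linear in `v`. -/
structure SesqForm where
  domain : Submodule ℂ E
  form : domain →ₗ[ℂ] domain →ₗ⋆[ℂ] ℂ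

/-- `h[u, u]` is real and nonnegative for all `u`. -/
def SesqForm.Nonneg (h : SesqForm E) : Prop := ∀ u : h.domain, 0 ≤ h.form u u

/-- A form is closed if `uₙ → x` in `E` and `h[uₙ - uₘ] → 0` imply that `x` is in the domain and
`h[uₙ - x] → 0`. -/
def SesqForm.Closed (h : SesqForm E) : Prop :=
  ∀ (a : ℕ → h.domain) (x : E),
    Tendsto (fun n => (a n : E)) atTop (𝓝 x) →
    Tendsto (fun p : ℕ × ℕ => h.form (a p.1 - a p.2) (a p.1 - a p.2)) atTop (𝓝 0) →
    ∃ hx : x ∈ h.domain,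
      Tendsto (fun n => h.form (a n - ⟨x, hx⟩) (a n - ⟨x, hx⟩)) atTop (𝓝 0)

/-- The form `h₀` is a closed restriction of the form `h₁`. -/
def SesqForm.IsClosedRestriction (h₀ h₁ : SesqForm E) : Prop :=
  h₀.Closed ∧ ∃ hle : h₀.domain ≤ h₁.domain, ∀ u v : h₀.domain,
    h₀.form u v = h₁.form ⟨u, hle u.2⟩ ⟨v, hle v.2⟩

/-- A linear relation `H` is selfadjoint and nonnegative. -/
structure IsNonnegSelfAdjoint (H : Submodule ℂ (E × E)) : Prop where
  selfAdjoint : H.adjoint = H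
  nonneg : ∀ p ∈ H, 0 ≤ inner ℂ p.1 p.2

/-- The inverse of a linear relation. -/
def relInv (H : Submodule ℂ (E × E)) : Submodule ℂ (E × E) :=
  H.map (LinearEquiv.prodComm ℂ E E).toLinearMap

/-- `h` is the closed nonnegative form corresponding to the relation `H`: the domain of `H` is
contained in that of `h`, and `h[f, k] = (f', k)` for `{f, f'} ∈ H` and `k ∈ dom h`. -/
structure IsFormOf (h : SesqForm E) (H : Submodule ℂ (E × E)) : Prop where
  nonneg : h.Nonneg
  closed : h.Closed
  repr : ∀ p ∈ H, ∃ hp : p.1 ∈ h.domain, ∀ k : h.domain,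
    h.form ⟨p.1, hp⟩ k = inner ℂ (k : E) p.2

open Classical in
/-- The closed form `H[·,·]` corresponding to a nonnegative selfadjoint relation `H`; it exists
(see `closedForm_spec`) and is unique (the zero form on `{0}` if `H` has no such form). -/
def closedForm (H : Submodule ℂ (E × E)) : SesqForm E :=
  if h : ∃ f : SesqForm E, IsFormOf f H then h.choose else ⟨⊥, 0⟩

end Forms

section Operators

variable {E : Type*} [NormedAddCommGroup E] [InnerProductSpace ℂ E] [CompleteSpace E]

/-- An operator is nonnegative if `(T x, x) ≥ 0` on its domain. -/
def IsNonneg (T : E →ₗ.[ℂ] E) : Prop := ∀ x : T.domain, 0 ≤ inner ℂ (x : E) (T x)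

/-- `T` is a nonnegative selfadjoint square root of `A`: `T` is nonnegative and selfadjoint and
`T ∘ T = A`, where `T ∘ T` has its maximal domain. -/
structure IsSqrt (T A : E →ₗ.[ℂ] E) : Prop where
  selfAdjoint : IsSelfAdjoint T
  nonneg : IsNonneg T
  comp_eq : ∀ x y : E, (x, y) ∈ A.graph ↔ ∃ z : E, (x, z) ∈ T.graph ∧ (z, y) ∈ T.graph

open Classical in
/-- The square root `A^{1/2}` of a nonnegative selfadjoint operator `A`; it exists (see
`opSqrt_spec`) and is unique (the zero operator on `{0}` if there is no nonnegative selfadjoint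
square root). -/
def opSqrt (A : E →ₗ.[ℂ] E) : E →ₗ.[ℂ] E :=
  if h : ∃ T : E →ₗ.[ℂ] E, IsSqrt T A then h.choose else ⊥

/-- The standing assumptions: `S` is a densely defined nonnegative symmetric operator, `S₀` and
`S₁` are nonnegative selfadjoint extensions of `S` with `dom S₁ ∩ dom S₀ = dom S`, and the form
of `S₀` is a closed restriction of the form of `S₁`. -/
structure IsExtensionPair (S S₀ S₁ : E →ₗ.[ℂ] E) : Prop where
  dense : Dense (S.domain : Set E)
  symm : S.IsFormalAdjoint S
  nonneg : IsNonneg S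
  selfAdjoint₀ : IsSelfAdjoint S₀
  nonneg₀ : IsNonneg S₀
  selfAdjoint₁ : IsSelfAdjoint S₁
  nonneg₁ : IsNonneg S₁
  le₀ : S ≤ S₀
  le₁ : S ≤ S₁
  domain_inf : S₁.domain ⊓ S₀.domain = S.domain
  form_restriction : (closedForm S₀.graph).IsClosedRestriction (closedForm S₁.graph)

/-- The additional conditions on the pair: `S₀ ∩ S₁ = S`, the form of `S₀` is a closed restriction
of the form of `S₁`, and the form of `S₁⁻¹` is a closed restriction of the form of `S₀⁻¹`, where
the inverses are linear relations. -/
structure IsSpecialPair (S S₀ S₁ : E →ₗ.[ℂ] E) : Prop where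
  inter : S₀.graph ⊓ S₁.graph = S.graph
  form_restriction : (closedForm S₀.graph).IsClosedRestriction (closedForm S₁.graph)
  inv_form_restriction :
    (closedForm (relInv S₁.graph)).IsClosedRestriction (closedForm (relInv S₀.graph))

/-- The form domain `D[T]` of a nonnegative selfadjoint operator `T`. -/
abbrev formDomain (T : E →ₗ.[ℂ] E) : Submodule ℂ E := (closedForm T.graph).domain

/-- `T[u, v]` for `u, v ∈ D[T]`. -/
abbrev opForm (T : E →ₗ.[ℂ] E) : formDomain T →ₗ[ℂ] formDomain T →ₗ⋆[ℂ] ℂ :=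
  (closedForm T.graph).form

/-- The orthogonal complement of `D[S₀]` in `D[S₁]` with respect to the inner product
`S₁[f, g] + (f, g)` (as a subspace of `E`). -/
def formComplement (S₀ S₁ : E →ₗ.[ℂ] E) : Submodule ℂ E where
  carrier := {g | ∃ hg : g ∈ formDomain S₁, ∀ f : formDomain S₁, (f : E) ∈ formDomain S₀ →
    opForm S₁ ⟨g, hg⟩ f + inner ℂ (f : E) g = 0}
  zero_mem' := by
    refine ⟨zero_mem _, fun f _ => ?_⟩
    have : (⟨0, zero_mem _⟩ : formDomain S₁) = 0 := rfl
    rw [this]; simp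
  add_mem' := by
    rintro a b ⟨ha, ha'⟩ ⟨hb, hb'⟩
    refine ⟨add_mem ha hb, fun f hf => ?_⟩
    have : (⟨a + b, add_mem ha hb⟩ : formDomain S₁) = ⟨a, ha⟩ + ⟨b, hb⟩ := rfl
    rw [this, map_add, LinearMap.add_apply, inner_add_right]
    linear_combination ha' f hf + hb' f hf
  smul_mem' := by
    rintro c a ⟨ha, ha'⟩
    refine ⟨Submodule.smul_mem _ c ha, fun f hf => ?_⟩
    have : (⟨c • a, Submodule.smul_mem _ c ha⟩ : formDomain S₁) = c • ⟨a, ha⟩ := rfl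
    rw [this, map_smul, LinearMap.smul_apply, inner_smul_right, smul_eq_mul]
    linear_combination c * ha' f hf

/-- The linear manifold `L = dom S₀ ∔ (D[S₁] ⊖ D[S₀])`. -/
def boundaryDomain (S₀ S₁ : E →ₗ.[ℂ] E) : Submodule ℂ E :=
  S₀.domain ⊔ formComplement S₀ S₁

variable {K : Type*} [NormedAddCommGroup K] [InnerProductSpace ℂ K] [CompleteSpace K]

/-- `{K, Γ₀}` is a boundary pair for `{S₀, S₁}`: `Γ₀` is continuous from the Hilbert space `D[S₁]`
with the norm `(S₁[v] + ‖v‖²)^{1/2}` to `K`, its kernel is `D[S₀]`, and its range is `K`. -/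
structure IsBoundaryPair (S₀ S₁ : E →ₗ.[ℂ] E) (Γ₀ : formDomain S₁ →ₗ[ℂ] K) : Prop where
  bounded : ∃ C : ℝ, ∀ v, ‖Γ₀ v‖ ≤ C * √((opForm S₁ v v).re + ‖(v : E)‖ ^ 2)
  ker : ∀ v, Γ₀ v = 0 ↔ (v : E) ∈ formDomain S₀
  surjective : Function.Surjective Γ₀

/-- `{K, Γ₀, Γ₁}` is a boundary triplet for `{S₀, S₁}`: `{K, Γ₀}` is a boundary pair and
`Γ₁ : L → K` is the operator with `S₁[u, v] = (S* u, v) - (Γ₁ u, Γ₀ v)` for `u ∈ L`,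
`v ∈ D[S₁]`. -/
structure IsBoundaryTriplet (S S₀ S₁ : E →ₗ.[ℂ] E) (Γ₀ : formDomain S₁ →ₗ[ℂ] K)
    (Γ₁ : boundaryDomain S₀ S₁ →ₗ[ℂ] K) : Prop extends IsBoundaryPair S₀ S₁ Γ₀ where
  green : ∀ (u : boundaryDomain S₀ S₁) (hD : (u : E) ∈ formDomain S₁) (hS : (u : E) ∈ S†.domain)
    (v : formDomain S₁),
    opForm S₁ ⟨u, hD⟩ v = inner ℂ (v : E) (S† ⟨u, hS⟩) - inner ℂ (Γ₀ v) (Γ₁ u)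

/-- The pairs `(u, Γ₀ u)` with `u ∈ L`, as a subspace of `E ⊕ K`.  (Under the standing assumptions
`L` is contained in `dom S*` and in `D[S₁]`.) -/
def mainDomain (S S₀ S₁ : E →ₗ.[ℂ] E) (Γ₀ : formDomain S₁ →ₗ[ℂ] K) :
    Submodule ℂ (WithLp 2 (E × K)) where
  carrier := {x | x.fst ∈ boundaryDomain S₀ S₁ ∧ x.fst ∈ S†.domain ∧
    ∃ hD : x.fst ∈ formDomain S₁, Γ₀ ⟨x.fst, hD⟩ = x.snd}
  zero_mem' := ⟨zero_mem _, zero_mem _, zero_mem _, map_zero Γ₀⟩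
  add_mem' := by
    rintro a b ⟨ha, ha', ha'', ea⟩ ⟨hb, hb', hb'', eb⟩
    refine ⟨add_mem ha hb, add_mem ha' hb', add_mem ha'' hb'', ?_⟩
    rw [WithLp.add_snd, ← ea, ← eb, ← map_add]; rfl
  smul_mem' := by
    rintro c a ⟨ha, ha', ha'', ea⟩
    refine ⟨Submodule.smul_mem _ c ha, Submodule.smul_mem _ c ha',
      Submodule.smul_mem _ c ha'', ?_⟩
    rw [WithLp.smul_snd, ← ea, ← map_smul]; rfl

/-- The main transform: the operator `(u, Γ₀ u) ↦ (S* u, -Γ₁ u)`, `u ∈ L`, in the Hilbert space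
`E ⊕ K`. -/
def mainTransform (S S₀ S₁ : E →ₗ.[ℂ] E) (Γ₀ : formDomain S₁ →ₗ[ℂ] K)
    (Γ₁ : boundaryDomain S₀ S₁ →ₗ[ℂ] K) : WithLp 2 (E × K) →ₗ.[ℂ] WithLp 2 (E × K) where
  domain := mainDomain S S₀ S₁ Γ₀
  toFun :=
    { toFun := fun x => WithLp.toLp 2 (S† ⟨x.1.fst, x.2.2.1⟩, -Γ₁ ⟨x.1.fst, x.2.1⟩)
      map_add' := by
        intro a b
        have h₁ : S† ⟨(a + b).1.fst, (a + b).2.2.1⟩ =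
            S† ⟨a.1.fst, a.2.2.1⟩ + S† ⟨b.1.fst, b.2.2.1⟩ := (S†.map_add _ _).symm ▸ rfl
        have h₂ : Γ₁ ⟨(a + b).1.fst, (a + b).2.1⟩ =
            Γ₁ ⟨a.1.fst, a.2.1⟩ + Γ₁ ⟨b.1.fst, b.2.1⟩ := (map_add Γ₁ _ _).symm ▸ rfl
        rw [h₁, h₂, neg_add, ← Prod.mk_add_mk, WithLp.toLp_add]
      map_smul' := by
        intro c a
        have h₁ : S† ⟨(c • a).1.fst, (c • a).2.2.1⟩ = c • S† ⟨a.1.fst, a.2.2.1⟩ :=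
          (S†.map_smul c _).symm ▸ rfl
        have h₂ : Γ₁ ⟨(c • a).1.fst, (c • a).2.1⟩ = c • Γ₁ ⟨a.1.fst, a.2.1⟩ :=
          (map_smul Γ₁ c _).symm ▸ rfl
        rw [h₁, h₂, ← smul_neg, ← Prod.smul_mk, WithLp.toLp_smul, RingHom.id_apply] }

end Operators

/-! Existence of the closed form and of the square root, so that the default values in
`closedForm` and `opSqrt` never occur for nonnegative selfadjoint relations and operators. -/

section Existence

variable {E : Type*} [NormedAddCommGroup E] [InnerProductSpace ℂ E] [CompleteSpace E]

theorem IsNonnegSelfAdjoint.symm {H : Submodule ℂ (E × E)} (hH : IsNonnegSelfAdjoint H)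
    {p q : E × E} (hp : p ∈ H) (hq : q ∈ H) : inner ℂ p.2 q.1 = inner ℂ p.1 q.2 := by
  rw [← hH.selfAdjoint, Submodule.mem_adjoint_iff] at hq
  exact sub_eq_zero.1 (hq p.1 p.2 hp)

theorem IsNonnegSelfAdjoint.isClosed {H : Submodule ℂ (E × E)} (hH : IsNonnegSelfAdjoint H) :
    IsClosed (H : Set (E × E)) := by
  have : (H : Set (E × E)) = ⋂ p ∈ H, {x : E × E | inner ℂ p.2 x.1 - inner ℂ p.1 x.2 = 0} := by
    ext x
    simp only [Set.mem_iInter, Set.mem_ofPred_eq, SetLike.mem_coe]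
    rw [← hH.selfAdjoint, Submodule.mem_adjoint_iff]
    constructor
    · intro h p hp
      rw [hH.selfAdjoint] at hp
      exact h p.1 p.2 hp
    · intro h a b hab
      rw [hH.selfAdjoint] at h
      exact h (a, b) hab
  rw [this]
  refine isClosed_biInter fun p _ => isClosed_eq (by fun_prop) continuous_const

/-- The resolvent `(H + I)⁻¹`. -/
theorem IsNonnegSelfAdjoint.exists_resolvent {H : Submodule ℂ (E × E)}
    (hH : IsNonnegSelfAdjoint H) :
    ∃ R : E →L[ℂ] E, (∀ x, (R x, x - R x) ∈ H) ∧ ∀ p ∈ H, R (p.1 + p.2) = p.1 := by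
  have key : ∀ p ∈ H, ‖p.1‖ ^ 2 + ‖p.2‖ ^ 2 ≤ ‖p.1 + p.2‖ ^ 2 := by
    intro p hp
    have h1 := (Complex.le_def.1 (hH.nonneg p hp)).1
    have h2 := norm_add_sq (𝕜 := ℂ) p.1 p.2
    simp only [Complex.zero_re, RCLike.re_to_complex] at h1 h2
    linarith
  have key1 : ∀ p ∈ H, ‖p.1‖ ≤ ‖p.1 + p.2‖ := fun p hp =>
    abs_le_of_sq_le_sq' (by nlinarith [key p hp, sq_nonneg ‖p.2‖]) (norm_nonneg _) |>.2
  have key2 : ∀ p ∈ H, ‖p.2‖ ≤ ‖p.1 + p.2‖ := fun p hp =>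
    abs_le_of_sq_le_sq' (by nlinarith [key p hp, sq_nonneg ‖p.1‖]) (norm_nonneg _) |>.2
  have : CompleteSpace H := hH.isClosed.completeSpace_coe
  let f : H →L[ℂ] E :=
    (ContinuousLinearMap.fst ℂ E E + ContinuousLinearMap.snd ℂ E E).comp H.subtypeL
  have hf : ∀ p : H, f p = p.1.1 + p.1.2 := fun p => rfl
  have hanti : AntilipschitzWith 1 f := by
    refine AddMonoidHomClass.antilipschitz_of_bound f fun p => ?_
    rw [NNReal.coe_one, one_mul, hf, Submodule.coe_norm, Prod.norm_def]
    exact max_le (key1 p p.2) (key2 p p.2)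
  have hcl : IsClosed (LinearMap.range (f : H →ₗ[ℂ] E) : Set E) := by
    exact hanti.isClosed_range f.uniformContinuous
  have hsurj : LinearMap.range (f : H →ₗ[ℂ] E) = ⊤ := by
    have : CompleteSpace (LinearMap.range (f : H →ₗ[ℂ] E)) := hcl.completeSpace_coe
    rw [← Submodule.orthogonal_eq_bot_iff, eq_bot_iff]
    intro x hx
    rw [Submodule.mem_orthogonal] at hx
    have hxH : (x, -x) ∈ H := by
      rw [← hH.selfAdjoint, Submodule.mem_adjoint_iff]
      intro a b hab
      have := hx (a + b) ⟨⟨(a, b), hab⟩, rfl⟩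
      rw [inner_add_left] at this
      simp only [inner_neg_right, sub_neg_eq_add]
      rw [add_comm]; exact this
    have h1 := key1 _ hxH
    simpa using h1
  choose g hg using fun x : E => (LinearMap.range_eq_top.1 hsurj) x
  have hinj : Function.Injective f := hanti.injective
  let L : E →ₗ[ℂ] E :=
    { toFun := fun x => (g x).1.1
      map_add' := fun x y => by
        have : g (x + y) = g x + g y := hinj (by
          rw [map_add]; exact (hg _).trans (congrArg₂ _ (hg x).symm (hg y).symm))
        rw [this]; rfl
      map_smul' := fun c x => by
        have : g (c • x) = c • g x := hinj (by
          rw [map_smul]; exact (hg _).trans (congrArg _ (hg x).symm))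
        rw [this]; rfl }
  have hsum : ∀ x, (g x).1.1 + (g x).1.2 = x := fun x => hg x
  refine ⟨L.mkContinuous 1 fun x => ?_, fun x => ?_, fun p hp => ?_⟩
  · rw [one_mul]
    exact (key1 _ (g x).2).trans_eq (by rw [hsum])
  · have : x - L x = (g x).1.2 := sub_eq_iff_eq_add'.2 (hsum x).symm
    change (L x, x - L x) ∈ H
    rw [this]; exact (g x).2
  · change (g (p.1 + p.2)).1.1 = p.1
    have : g (p.1 + p.2) = ⟨p, hp⟩ := hinj (hg _)
    rw [this]

/-- Commuting bounded selfadjoint operators `P`, `Q` with `P² = (H + I)⁻¹` and `Q² = I - P²`. -/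
theorem IsNonnegSelfAdjoint.exists_sqrt_resolvent {H : Submodule ℂ (E × E)}
    (hH : IsNonnegSelfAdjoint H) :
    ∃ P Q : E →L[ℂ] E, P.IsPositive ∧ Q.IsPositive ∧ (∀ x, P (Q x) = Q (P x)) ∧
      (∀ x, Q (Q x) + P (P x) = x) ∧ (∀ x, (P (P x), Q (Q x)) ∈ H) ∧
      ∀ p ∈ H, P (P (p.1 + p.2)) = p.1 := by
  obtain ⟨R, hR, hR'⟩ := hH.exists_resolvent
  have hsym : ∀ x y, inner ℂ (R x) y = inner ℂ x (R y) := by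
    intro x y
    have := hH.symm (hR x) (hR y)
    simp only [inner_sub_left, inner_sub_right] at this
    linear_combination -this
  have hpos : ∀ x, 0 ≤ (inner ℂ (R x) (x - R x)).re := fun x =>
    (Complex.le_def.1 (hH.nonneg _ (hR x))).1
  have hRpos : R.IsPositive := by
    refine ⟨fun x y => hsym x y, fun x => ?_⟩
    have h1 : inner ℂ (R x) x = inner ℂ (R x) (x - R x) + inner ℂ (R x) (R x) := by
      rw [← inner_add_right, sub_add_cancel]
    have h2 := inner_self_nonneg (𝕜 := ℂ) (x := R x)
    simp only [ContinuousLinearMap.reApplyInnerSelf_apply, RCLike.re_to_complex] at *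
    change 0 ≤ (inner ℂ (R x) x).re
    rw [h1, Complex.add_re]; linarith [hpos x]
  have hQpos : (1 - R : E →L[ℂ] E).IsPositive := by
    refine ⟨fun x y => ?_, fun x => ?_⟩
    · change inner ℂ (x - R x) y = inner ℂ x (y - R y)
      rw [inner_sub_left, inner_sub_right, hsym]
    · change 0 ≤ (inner ℂ (x - R x) x).re
      have h1 : inner ℂ (x - R x) x = inner ℂ (x - R x) (x - R x) + inner ℂ (x - R x) (R x) := by
        rw [← inner_add_right, sub_add_cancel]
      have h2 := inner_self_nonneg (𝕜 := ℂ) (x := x - R x)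
      have h3 : (inner ℂ (x - R x) (R x)).re = (inner ℂ (R x) (x - R x)).re := by
        rw [← inner_conj_symm, Complex.conj_re]
      simp only [RCLike.re_to_complex] at h2
      rw [h1, Complex.add_re, h3]; linarith [hpos x]
  have h0 : (0 : E →L[ℂ] E) ≤ R := ContinuousLinearMap.nonneg_iff_isPositive R |>.2 hRpos
  have h1 : (0 : E →L[ℂ] E) ≤ 1 - R := ContinuousLinearMap.nonneg_iff_isPositive _ |>.2 hQpos
  have hc : Commute R (1 - R) := (Commute.one_right R).sub_right (Commute.refl R)
  have hc2 : Commute (CFC.sqrt R) (CFC.sqrt (1 - R)) :=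
    ((hc.cfcₙ_nnreal NNReal.sqrt).symm.cfcₙ_nnreal NNReal.sqrt).symm
  have hP : ∀ x, CFC.sqrt R (CFC.sqrt R x) = R x := fun x =>
    DFunLike.congr_fun (CFC.sqrt_mul_sqrt_self R h0) x
  have hQ : ∀ x, CFC.sqrt (1 - R) (CFC.sqrt (1 - R) x) = x - R x := fun x =>
    DFunLike.congr_fun (CFC.sqrt_mul_sqrt_self (1 - R) h1) x
  refine ⟨CFC.sqrt R, CFC.sqrt (1 - R),
    (ContinuousLinearMap.nonneg_iff_isPositive _).1 (CFC.sqrt_nonneg R),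
    (ContinuousLinearMap.nonneg_iff_isPositive _).1 (CFC.sqrt_nonneg _),
    fun x => DFunLike.congr_fun hc2.eq x, fun x => ?_, fun x => ?_, fun p hp => ?_⟩
  · rw [hP, hQ, sub_add_cancel]
  · rw [hP, hQ]; exact hR x
  · rw [hP]; exact hR' p hp

/-- Every nonnegative selfadjoint relation has a closed form. -/
theorem IsNonnegSelfAdjoint.exists_isFormOf {H : Submodule ℂ (E × E)}
    (hH : IsNonnegSelfAdjoint H) : ∃ h : SesqForm E, IsFormOf h H := by
  obtain ⟨P, Q, hP, hQ, hPQ, hsum, hmem, hres⟩ := hH.exists_sqrt_resolvent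
  -- `P` is injective on the orthogonal complement of its kernel
  let N : Submodule ℂ E := (LinearMap.ker (P : E →ₗ[ℂ] E))ᗮ
  let p : N →ₗ[ℂ] E := (P : E →ₗ[ℂ] E) ∘ₗ N.subtype
  have hp : Function.Injective p := by
    rw [← LinearMap.ker_eq_bot, eq_bot_iff]
    intro x hx
    have hx' : (x : E) ∈ LinearMap.ker (P : E →ₗ[ℂ] E) := hx
    have := Submodule.inner_right_of_mem_orthogonal hx' x.2
    exact Subtype.ext (inner_self_eq_zero.1 this)
  let e : N ≃ₗ[ℂ] LinearMap.range p := LinearEquiv.ofInjective p hp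
  have he : ∀ x : N, ((e x : LinearMap.range p) : E) = P x := fun x => rfl
  have hes : ∀ u : LinearMap.range p, P (e.symm u : E) = u := fun u => by
    rw [← he, e.apply_symm_apply]
  have hPN : ∀ x, P x ∈ N := fun x => by
    rw [Submodule.mem_orthogonal]
    intro y hy
    have : P y = 0 := hy
    rw [← hP.isSymmetric.apply_clm, this, inner_zero_left]
  let q : LinearMap.range p →ₗ[ℂ] E := (Q : E →ₗ[ℂ] E) ∘ₗ N.subtype ∘ₗ e.symm.toLinearMap
  have hq : ∀ u, q u = Q (e.symm u : E) := fun u => rfl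
  have hN : ∀ y : E, ‖y‖ ^ 2 = ‖Q y‖ ^ 2 + ‖P y‖ ^ 2 := fun y => by
    have h1 : inner ℂ y y = inner ℂ (Q y) (Q y) + inner ℂ (P y) (P y) := by
      rw [hQ.isSymmetric.apply_clm, hP.isSymmetric.apply_clm, ← inner_add_right, hsum]
    have h2 := congrArg Complex.re h1
    rw [Complex.add_re] at h2
    simpa only [← RCLike.re_to_complex, inner_self_eq_norm_sq] using h2
  let h : SesqForm E :=
    { domain := LinearMap.range p
      form := LinearMap.mk₂'ₛₗ (RingHom.id ℂ) (starRingEnd ℂ) (fun u v => inner ℂ (q v) (q u))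
        (fun u u' v => by rw [map_add, inner_add_right])
        (fun c u v => by rw [map_smul, inner_smul_right]; rfl)
        (fun u v v' => by rw [map_add, inner_add_left])
        (fun c u v => by rw [map_smul, inner_smul_left]; rfl) }
  have hform : ∀ u v : LinearMap.range p, h.form u v = inner ℂ (q v) (q u) := fun u v => rfl
  have hself : ∀ u : LinearMap.range p, h.form u u = ((‖q u‖ ^ 2 : ℝ) : ℂ) := fun u => by
    rw [hform, inner_self_eq_norm_sq_to_K]; push_cast; rfl
  refine ⟨h, ⟨fun u => ?_, fun a x hx ha => ?_, fun r hr => ?_⟩⟩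
  · have := hself u
    rw [this]
    exact Complex.zero_le_real.2 (sq_nonneg _)
  · have hq2 : Tendsto (fun t : ℕ × ℕ => ‖q (a t.1 - a t.2)‖ ^ 2) atTop (𝓝 0) := by
      have h1 := (Complex.continuous_re.tendsto 0).comp ha
      refine h1.congr fun t => ?_
      exact (congrArg Complex.re (hself _)).trans (Complex.ofReal_re _)
    have hx2 : Tendsto (fun t : ℕ × ℕ => ‖(a t.1 : E) - a t.2‖ ^ 2) atTop (𝓝 0) := by
      have h1 := cauchySeq_iff_tendsto_dist_atTop_0.1 hx.cauchySeq
      simpa [dist_eq_norm] using h1.pow 2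
    have hcau : CauchySeq fun n => (e.symm (a n) : N) := by
      rw [cauchySeq_iff_tendsto_dist_atTop_0]
      have h1 := (hq2.add hx2).sqrt
      rw [add_zero, Real.sqrt_zero] at h1
      refine h1.congr fun t => ?_
      rw [dist_eq_norm, ← map_sub e.symm (a t.1) (a t.2), Submodule.coe_norm,
        ← Real.sqrt_sq (norm_nonneg ((e.symm (a t.1 - a t.2) : N) : E)),
        hN ((e.symm (a t.1 - a t.2) : N) : E), hes (a t.1 - a t.2)]
      rfl
    obtain ⟨y, hy⟩ := cauchySeq_tendsto_of_complete hcau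
    have hy' : Tendsto (fun n => ((e.symm (a n) : N) : E)) atTop (𝓝 (y : E)) :=
      (continuous_subtype_val.tendsto y).comp hy
    have hPy : P y = x := by
      refine tendsto_nhds_unique (((P.continuous.tendsto _).comp hy').congr fun n => ?_) hx
      exact hes (a n)
    have hxe : x = (e y : E) := hPy.symm
    subst hxe
    refine ⟨(e y).2, ?_⟩
    have h1 : Tendsto (fun n => q (a n - e y)) atTop (𝓝 0) := by
      have h2 : Tendsto (fun n => Q (((e.symm (a n) : N) : E) - y)) atTop (𝓝 (Q (y - y))) :=
        (Q.continuous.tendsto _).comp (hy'.sub_const _)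
      rw [sub_self, map_zero] at h2
      refine h2.congr fun n => ?_
      rw [hq, map_sub e.symm, e.symm_apply_apply]; rfl
    have h3 := h1.inner (𝕜 := ℂ) h1
    rw [inner_zero_left] at h3
    exact h3
  · have hz : (e ⟨P (r.1 + r.2), hPN _⟩ : E) = r.1 := hres r hr
    have hr1 : r.1 ∈ LinearMap.range p := hz ▸ (e ⟨P (r.1 + r.2), hPN _⟩).2
    refine ⟨hr1, fun k => ?_⟩
    have hes' : e.symm ⟨r.1, hr1⟩ = ⟨P (r.1 + r.2), hPN _⟩ :=
      e.symm_apply_eq.2 (Subtype.ext hz.symm)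
    have h2 : Q (Q (r.1 + r.2)) = r.2 := by
      have := hsum (r.1 + r.2)
      rw [hres r hr, add_comm] at this
      exact add_left_cancel this
    refine (hform _ _).trans ?_
    rw [hq, hq, hes']
    change inner ℂ (Q _) (Q (P (r.1 + r.2))) = _
    rw [hQ.isSymmetric.apply_clm, ← hPQ, ← hPQ, h2, ← hP.isSymmetric.apply_clm, hes]

theorem closedForm_spec {H : Submodule ℂ (E × E)} (hH : IsNonnegSelfAdjoint H) :
    IsFormOf (closedForm H) H := by
  rw [closedForm, dif_pos hH.exists_isFormOf]
  exact hH.exists_isFormOf.choose_spec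

theorem isNonnegSelfAdjoint_graph {A : E →ₗ.[ℂ] E} (hA : IsSelfAdjoint A) (h : IsNonneg A) :
    IsNonnegSelfAdjoint A.graph := by
  refine ⟨?_, fun r hr => ?_⟩
  · rw [← LinearPMap.adjoint_graph_eq_graph_adjoint hA.dense_domain,
      LinearPMap.isSelfAdjoint_def.1 hA]
  · obtain ⟨x, h1, h2⟩ := (LinearPMap.mem_graph_iff A).1 hr
    rw [← h1, ← h2]; exact h x

theorem IsNonnegSelfAdjoint.relInv {H : Submodule ℂ (E × E)} (hH : IsNonnegSelfAdjoint H) :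
    IsNonnegSelfAdjoint (relInv H) := by
  have hmem : ∀ r : E × E, r ∈ NonnegExt.relInv H ↔ (r.2, r.1) ∈ H := fun r => by
    constructor
    · rintro ⟨s, hs, rfl⟩; exact hs
    · intro hr; exact ⟨_, hr, rfl⟩
  refine ⟨?_, fun r hr => ?_⟩
  · ext r
    rw [hmem, ← hH.selfAdjoint, Submodule.mem_adjoint_iff, Submodule.mem_adjoint_iff,
      hH.selfAdjoint]
    constructor
    · intro h a b hab
      have := h b a ((hmem _).2 hab)
      rw [← neg_sub, neg_eq_zero]; exact this
    · intro h a b hab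
      have := h b a ((hmem _).1 hab)
      rw [← neg_sub, neg_eq_zero]; exact this
  · have := hH.nonneg _ ((hmem r).1 hr)
    rw [← inner_conj_symm]
    simpa using star_nonneg_iff.2 this

/-- Every nonnegative selfadjoint operator has a nonnegative selfadjoint square root. -/
theorem exists_isSqrt {A : E →ₗ.[ℂ] E} (hA : IsSelfAdjoint A) (h : IsNonneg A) :
    ∃ T, IsSqrt T A := by
  obtain ⟨P, Q, hP, hQ, hPQ, hsum, hmem, hres⟩ :=
    (isNonnegSelfAdjoint_graph hA h).exists_sqrt_resolvent
  have hinj : ∀ x, P x = 0 → x = 0 := fun x hx => by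
    have h1 := hmem x
    have h2 := hsum x
    rw [hx, map_zero, add_zero] at h2
    rw [hx, map_zero, h2] at h1
    exact A.graph_fst_eq_zero_snd h1 rfl
  let e : E ≃ₗ[ℂ] LinearMap.range (P : E →ₗ[ℂ] E) :=
    LinearEquiv.ofInjective (P : E →ₗ[ℂ] E) ((injective_iff_map_eq_zero _).2 hinj)
  have he : ∀ x, (e x : E) = P x := fun x => rfl
  let T : E →ₗ.[ℂ] E := ⟨LinearMap.range (P : E →ₗ[ℂ] E), (Q : E →ₗ[ℂ] E) ∘ₗ e.symm.toLinearMap⟩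
  have hT : ∀ x : E, T (e x) = Q x := fun x => congrArg Q (e.symm_apply_apply x)
  have hT' : ∀ u : T.domain, ∃ x, u = e x := fun u => ⟨e.symm u, (e.apply_symm_apply u).symm⟩
  have hgr : ∀ a b, (a, b) ∈ T.graph ↔ ∃ x, P x = a ∧ Q x = b := fun a b => by
    rw [LinearPMap.mem_graph_iff]
    constructor
    · rintro ⟨u, h1, h2⟩
      obtain ⟨x, rfl⟩ := hT' u
      exact ⟨x, h1, (hT x).symm.trans h2⟩
    · rintro ⟨x, h1, h2⟩
      exact ⟨e x, h1, (hT x).trans h2⟩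
  have hdense : Dense (T.domain : Set E) := by
    rw [Submodule.dense_iff_topologicalClosure_eq_top,
      Submodule.topologicalClosure_eq_top_iff, eq_bot_iff]
    intro y hy
    rw [Submodule.mem_orthogonal] at hy
    refine hinj y ?_
    have := hy (P (P y)) ⟨P y, rfl⟩
    rw [hP.isSymmetric.apply_clm] at this
    exact inner_self_eq_zero.1 this
  have hsymm : T.IsFormalAdjoint T := fun u v => by
    obtain ⟨x, rfl⟩ := hT' u
    obtain ⟨y, rfl⟩ := hT' v
    rw [hT, hT]
    change inner ℂ (Q x) (P y) = inner ℂ (P x) (Q y)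
    rw [hQ.isSymmetric.apply_clm, hP.isSymmetric.apply_clm, hPQ]
  have hle : T ≤ T† := hsymm.le_adjoint hdense
  refine ⟨T, ⟨?_, fun u => ?_, fun x y => ?_⟩⟩
  · rw [LinearPMap.isSelfAdjoint_def]
    refine (LinearPMap.eq_of_le_of_domain_eq hle (le_antisymm hle.1 fun y hy => ?_)).symm
    have h1 : P (T† ⟨y, hy⟩) = Q y := by
      refine ext_inner_right ℂ fun x => ?_
      have h2 := LinearPMap.adjoint_isFormalAdjoint hdense ⟨y, hy⟩ (e x)
      rw [hT, he] at h2
      rw [hP.isSymmetric.apply_clm, h2, hQ.isSymmetric.apply_clm]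
    refine ⟨Q (T† ⟨y, hy⟩) + P y, ?_⟩
    change P _ = y
    rw [map_add, hPQ, h1, hsum]
  · obtain ⟨x, rfl⟩ := hT' u
    rw [hT, he]
    have hc : Commute P Q := ContinuousLinearMap.ext hPQ
    have h1 : (0 : E →L[ℂ] E) ≤ P * Q :=
      hc.mul_nonneg ((ContinuousLinearMap.nonneg_iff_isPositive _).2 hP)
        ((ContinuousLinearMap.nonneg_iff_isPositive _).2 hQ)
    have h2 := ((ContinuousLinearMap.nonneg_iff_isPositive _).1 h1).inner_nonneg_right x
    change 0 ≤ inner ℂ x (P (Q x)) at h2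
    rwa [hP.isSymmetric.apply_clm]
  · simp only [hgr]
    constructor
    · intro hxy
      have h1 : P (P (x + y)) = x := hres _ hxy
      have h2 : Q (Q (x + y)) = y := by
        have := hsum (x + y)
        rw [h1, add_comm] at this
        exact add_left_cancel this
      exact ⟨Q (P (x + y)), ⟨P (x + y), h1, rfl⟩, ⟨Q (x + y), hPQ _, h2⟩⟩
    · rintro ⟨z, ⟨a, rfl, rfl⟩, ⟨b, hb, rfl⟩⟩
      have h1 : a = P (P a + Q b) := by
        rw [map_add, hPQ, hb, add_comm, hsum]
      have h2 : b = Q (P a + Q b) := by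
        rw [map_add, ← hPQ, ← hb]
        rw [add_comm, hsum]
      have := hmem (P a + Q b)
      rwa [← h1, ← h2] at this

theorem opSqrt_spec {A : E →ₗ.[ℂ] E} (hA : IsSelfAdjoint A) (h : IsNonneg A) :
    IsSqrt (opSqrt A) A := by
  rw [opSqrt, dif_pos (exists_isSqrt hA h)]
  exact (exists_isSqrt hA h).choose_spec

end Existence

end NonnegExt

end

noncomputable section

namespace NonnegExt

/-! ### Nonnegative forms and the Hilbert space of a closed form -/

section FormSpaces

variable {E : Type*} [NormedAddCommGroup E] [InnerProductSpace ℂ E]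

/-! Put t[(u, Γ₀u), (v, Γ₀v)] = S₁[u, v] on the graph of Γ₀. Continuity of Γ₀ on D[S₁] makes t
closed (`transformForm_closed`), and Green's identity says precisely that the transform A represents
t: (A(u, Γ₀u), (v, Γ₀v)) = t[(u, Γ₀u), (v, Γ₀v)]. Symmetry and nonnegativity of A follow at once.

Selfadjointness reduces to surjectivity of A + I (`isSelfAdjoint_of_surjective`). Riesz
representation in the Hilbert space of t solves (A + I)x = y weakly, and the point is that the first
component u of the weak solution lies in L. Testing against D[S₀] = ker Γ₀ shows that u - (S₀ +
I)⁻¹y₁ is orthogonal to D[S₀] in D[S₁]. That complement lies in ker(S* + I), so the first component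
of the equation holds; Green's identity and surjectivity of Γ₀ give the second
(`mainTransform_add_self_surjective`).

The domain of a selfadjoint relation is a core of its form, so closed forms are unique; hence t is
the form of A. The form (A^{1/2}u, A^{1/2}v) is also a closed form of A, so dom A^{1/2} = D[A],
which meets {0} ⊕ K only in (0, Γ₀0) = 0.

For the last assertions, let f ∈ dom S₁ and k ∈ dom S₀. The condition on the inverses gives S₁[f -
k] = S₀⁻¹[S₁f - S₀k]. Since ran S₀ is a core of the form of S₀⁻¹, the right side can be made
arbitrarily small; density of dom S₁ in D[S₁] gives the infimum. If A^{1/2}x = (0, h), then (h, Γ₀v)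
= (x, A^{1/2}y) for every y = (v, Γ₀v) - (u, 0) with u ∈ dom S₀, and ‖A^{1/2}y‖² = A[y] has infimum
zero, so h ⟂ ran Γ₀ = K. -/

theorem SesqForm.Nonneg.im_eq_zero {h : SesqForm E} (hn : h.Nonneg) (u : h.domain) :
    (h.form u u).im = 0 :=
  (Complex.le_def.1 (hn u)).2.symm

theorem SesqForm.Nonneg.re_nonneg {h : SesqForm E} (hn : h.Nonneg) (u : h.domain) :
    0 ≤ (h.form u u).re :=
  (Complex.le_def.1 (hn u)).1

/-- Polarization: reality of h at u + v settles the imaginary parts, reality at u + iv the real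
parts. -/
theorem SesqForm.Nonneg.conj_form {h : SesqForm E} (hn : h.Nonneg) (u v : h.domain) :
    starRingEnd ℂ (h.form v u) = h.form u v := by
  have h1 := hn.im_eq_zero (u + v)
  have h2 := hn.im_eq_zero (u + Complex.I • v)
  have hu := hn.im_eq_zero u
  have hv := hn.im_eq_zero v
  simp only [map_add, map_smul, LinearMap.map_smulₛₗ, LinearMap.add_apply, LinearMap.smul_apply,
    smul_eq_mul, Complex.add_im, Complex.add_re, Complex.mul_im, Complex.mul_re, Complex.conj_I, Complex.neg_re,
    Complex.neg_im, Complex.I_re, Complex.I_im, hu, hv] at h1 h2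
  apply Complex.ext
  · rw [Complex.conj_re]; linarith
  · rw [Complex.conj_im]; linarith

/-- The parallelogram law for a form. -/
theorem SesqForm.form_parallelogram (h : SesqForm E) (u v : h.domain) :
    h.form (u + v) (u + v) + h.form (u - v) (u - v) = 2 * (h.form u u + h.form v v) := by
  simp only [map_add, map_sub, LinearMap.add_apply, LinearMap.sub_apply]
  ring

/-- The domain of a nonnegative form `h`, to be equipped with the inner product
`h[u, v] + (u, v)`. -/
def FormSpace (h : SesqForm E) (_ : h.Nonneg) : Type _ := h.domain

namespace FormSpace

variable {h : SesqForm E} {hn : h.Nonneg}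

/-- Only the linear structure is transported; the synonym hides the norm that `h.domain` inherits
from `E`. -/
instance : AddCommGroup (FormSpace h hn) := inferInstanceAs (AddCommGroup h.domain)
instance : Module ℂ (FormSpace h hn) := inferInstanceAs (Module ℂ h.domain)

variable (h hn) in
/-- The identification of a form domain with the inner product space it carries. -/
def equiv : h.domain ≃ₗ[ℂ] FormSpace h hn := LinearEquiv.refl ℂ h.domain

instance core : InnerProductSpace.Core ℂ (FormSpace h hn) where
  inner u v := h.form ((equiv h hn).symm v) ((equiv h hn).symm u) +
    inner ℂ ((equiv h hn).symm u : E) ((equiv h hn).symm v : E)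
  conj_inner_symm u v := by
    rw [map_add, hn.conj_form, inner_conj_symm]
  re_inner_nonneg u := by
    rw [map_add]
    exact add_nonneg (hn.re_nonneg _) inner_self_nonneg
  add_left u v w := by
    simp only [map_add, Submodule.coe_add, inner_add_left]
    ring
  smul_left u v c := by
    simp only [map_smul, LinearMap.map_smulₛₗ, Submodule.coe_smul, inner_smul_left, smul_eq_mul]
    ring
  definite u hu := by
    have h1 := congrArg Complex.re hu
    rw [Complex.add_re] at h1
    have h2 := hn.re_nonneg ((equiv h hn).symm u)
    have h3 : 0 ≤ (inner ℂ ((equiv h hn).symm u : E) ((equiv h hn).symm u : E)).re :=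
      inner_self_nonneg (𝕜 := ℂ)
    rw [Complex.zero_re] at h1
    have h4 : (inner ℂ ((equiv h hn).symm u : E) ((equiv h hn).symm u : E)).re = 0 := by linarith
    have h5 : (((equiv h hn).symm u : h.domain) : E) = 0 :=
      inner_self_eq_zero (𝕜 := ℂ) |>.1 (Complex.ext h4 (inner_self_im (𝕜 := ℂ) _))
    exact (equiv h hn).symm.map_eq_zero_iff.1 (Subtype.ext h5)

instance : NormedAddCommGroup (FormSpace h hn) :=
  InnerProductSpace.Core.toNormedAddCommGroup (𝕜 := ℂ) (cd := core)

instance : InnerProductSpace ℂ (FormSpace h hn) := InnerProductSpace.ofCore core.toCore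

theorem inner_equiv (u v : h.domain) :
    inner ℂ (equiv h hn u) (equiv h hn v) = h.form v u + inner ℂ (u : E) (v : E) := rfl

theorem norm_equiv_sq (u : h.domain) :
    ‖equiv h hn u‖ ^ 2 = (h.form u u).re + ‖(u : E)‖ ^ 2 := by
  have h1 := inner_self_eq_norm_sq (𝕜 := ℂ) (equiv h hn u)
  rw [← h1, inner_equiv, map_add, inner_self_eq_norm_sq]
  rfl

theorem norm_coe_le (u : h.domain) : ‖(u : E)‖ ≤ ‖equiv h hn u‖ := by
  refine abs_le_of_sq_le_sq' ?_ (norm_nonneg _) |>.2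
  rw [norm_equiv_sq]
  linarith [hn.re_nonneg u]

theorem form_re_le (u : h.domain) : (h.form u u).re ≤ ‖equiv h hn u‖ ^ 2 := by
  rw [norm_equiv_sq]
  linarith [sq_nonneg ‖(u : E)‖]

theorem norm_equiv (u : h.domain) :
    ‖equiv h hn u‖ = √((h.form u u).re + ‖(u : E)‖ ^ 2) := by
  rw [← norm_equiv_sq (hn := hn), Real.sqrt_sq (norm_nonneg _)]

variable (h hn) in
/-- The embedding of a form domain into the underlying space. -/
def embed : FormSpace h hn →L[ℂ] E :=
  (h.domain.subtype ∘ₗ (equiv h hn).symm.toLinearMap).mkContinuous 1 fun u => by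
    rw [one_mul]
    exact norm_coe_le ((equiv h hn).symm u)

theorem embed_equiv (u : h.domain) : embed h hn (equiv h hn u) = u := rfl

theorem tendsto_form_zero {ι : Type*} {l : Filter ι} {a : ι → h.domain}
    (ha : Tendsto (fun i => equiv h hn (a i)) l (𝓝 0)) :
    Tendsto (fun i => h.form (a i) (a i)) l (𝓝 0) := by
  have h1 : Tendsto (fun i => ‖equiv h hn (a i)‖ ^ 2) l (𝓝 0) := by
    simpa using ha.norm.pow 2
  refine squeeze_zero_norm (fun i => ?_) h1
  rw [← Complex.re_add_im (h.form (a i) (a i)), hn.im_eq_zero]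
  simp only [Complex.ofReal_zero, zero_mul, add_zero, Complex.norm_real, Real.norm_eq_abs]
  rw [abs_of_nonneg (hn.re_nonneg _)]
  exact form_re_le _

/-- The form is the difference of the inner products of `FormSpace` and of `E`, and both are
continuous for the form norm. -/
theorem tendsto_form_left {ι : Type*} {l : Filter ι} {a : ι → h.domain} {x : h.domain}
    (ha : Tendsto (fun i => equiv h hn (a i)) l (𝓝 (equiv h hn x))) (k : h.domain) :
    Tendsto (fun i => h.form (a i) k) l (𝓝 (h.form x k)) := by
  have h1 := (tendsto_const_nhds (x := equiv h hn k)).inner (𝕜 := ℂ) ha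
  have h2 := (tendsto_const_nhds (x := (k : E))).inner (𝕜 := ℂ)
    (((embed h hn).continuous.tendsto _).comp ha)
  have h3 := h1.sub h2
  simp only [inner_equiv, embed_equiv, Function.comp_apply, add_sub_cancel_right] at h3
  exact h3

theorem tendsto_form_sub {a : ℕ → h.domain}
    (ha : CauchySeq fun n => equiv h hn (a n)) :
    Tendsto (fun p : ℕ × ℕ => h.form (a p.1 - a p.2) (a p.1 - a p.2)) atTop (𝓝 0) := by
  refine tendsto_form_zero (hn := hn) ?_
  have h2 := cauchySeq_iff_tendsto_dist_atTop_0.1 ha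
  simp only [dist_eq_norm, ← map_sub] at h2
  exact tendsto_zero_iff_norm_tendsto_zero.2 h2

theorem tendsto_equiv {ι : Type*} {l : Filter ι} {a : ι → h.domain} {x : h.domain}
    (ha : Tendsto (fun i => (a i : E)) l (𝓝 x))
    (hf : Tendsto (fun i => h.form (a i - x) (a i - x)) l (𝓝 0)) :
    Tendsto (fun i => equiv h hn (a i)) l (𝓝 (equiv h hn x)) := by
  rw [tendsto_iff_norm_sub_tendsto_zero]
  have h3 : Tendsto (fun i => (h.form (a i - x) (a i - x)).re + ‖(a i : E) - x‖ ^ 2)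
      l (𝓝 0) := by
    have h4 := (Complex.continuous_re.tendsto 0).comp hf
    have h5 := (tendsto_iff_norm_sub_tendsto_zero.1 ha).pow 2
    simpa using h4.add h5
  have h6 := h3.sqrt
  rw [Real.sqrt_zero] at h6
  refine h6.congr fun n => ?_
  rw [← map_sub, norm_equiv]
  rfl

/-- A Cauchy sequence for the form norm converges in `E`, and closedness upgrades this to
convergence in the form norm. -/
theorem completeSpace [CompleteSpace E] (hc : h.Closed) : CompleteSpace (FormSpace h hn) := by
  refine Metric.complete_of_cauchySeq_tendsto fun b hb => ?_
  obtain ⟨a, rfl⟩ : ∃ a : ℕ → h.domain, b = fun n => equiv h hn (a n) :=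
    ⟨fun n => (equiv h hn).symm (b n), funext fun n => ((equiv h hn).apply_symm_apply _).symm⟩
  have hE : CauchySeq fun n => (a n : E) := (embed h hn).uniformContinuous.comp_cauchySeq hb
  obtain ⟨x, hxE⟩ := cauchySeq_tendsto_of_complete hE
  obtain ⟨hx, hlim⟩ := hc a x hxE (tendsto_form_sub hb)
  exact ⟨equiv h hn ⟨x, hx⟩, tendsto_equiv hxE hlim⟩

/-- The Riesz representation theorem in the domain of a closed form. -/
theorem exists_riesz [CompleteSpace E] (hn : h.Nonneg) (hc : h.Closed) (l : h.domain →ₗ⋆[ℂ] ℂ) (C : ℝ)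
    (hl : ∀ v : h.domain, ‖l v‖ ≤ C * √((h.form v v).re + ‖(v : E)‖ ^ 2)) :
    ∃ u : h.domain, ∀ v : h.domain, h.form u v + inner ℂ (v : E) u = l v := by
  have := completeSpace (hn := hn) hc
  let f : FormSpace h hn →ₗ⋆[ℂ] ℂ := l ∘ₛₗ (equiv h hn).symm.toLinearMap
  let F : FormSpace h hn →L⋆[ℂ] ℂ := f.mkContinuous C fun v => by
    refine (hl ((equiv h hn).symm v)).trans_eq ?_
    rw [← norm_equiv (hn := hn), LinearEquiv.apply_symm_apply]
  -- Conjugation turns the antilinear functional into a linear one, to which Riesz applies.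
  let G : FormSpace h hn →L[ℂ] ℂ := (starL ℂ : ℂ ≃L⋆[ℂ] ℂ).toContinuousLinearMap.comp F
  refine ⟨(equiv h hn).symm ((InnerProductSpace.toDual ℂ _).symm G), fun v => ?_⟩
  have h1 := InnerProductSpace.toDual_symm_apply (𝕜 := ℂ) (x := equiv h hn v) (y := G)
  rw [← inner_conj_symm] at h1
  have h2 := congrArg (starRingEnd ℂ) h1
  rw [Complex.conj_conj] at h2
  refine Eq.trans ?_ (h2.trans ?_)
  · rfl
  · exact Complex.conj_conj (l v)

/-- A subspace of the domain of a closed form whose orthogonal complement is trivial is a core. -/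
theorem exists_tendsto_of_orthogonal [CompleteSpace E] (hn : h.Nonneg) (hc : h.Closed) (M : Submodule ℂ h.domain)
    (hM : ∀ k : h.domain, (∀ f ∈ M, h.form f k + inner ℂ (k : E) f = 0) → k = 0)
    (x : h.domain) :
    ∃ a : ℕ → h.domain, (∀ n, a n ∈ M) ∧
      Tendsto (fun n => equiv h hn (a n)) atTop (𝓝 (equiv h hn x)) := by
  have := completeSpace (hn := hn) hc
  have h1 : (M.map (equiv h hn).toLinearMap).topologicalClosure = ⊤ := by
    rw [Submodule.topologicalClosure_eq_top_iff, eq_bot_iff]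
    intro k hk
    rw [Submodule.mem_orthogonal'] at hk
    have := hM ((equiv h hn).symm k) fun f hf => hk _ ⟨f, hf, rfl⟩
    exact (equiv h hn).symm.map_eq_zero_iff.1 this
  have h2 : equiv h hn x ∈ closure (M.map (equiv h hn).toLinearMap : Set (FormSpace h hn)) := by
    rw [← Submodule.topologicalClosure_coe, h1]
    trivial
  obtain ⟨b, hb, hlim⟩ := mem_closure_iff_seq_limit.1 h2
  choose a ha hab using hb
  exact ⟨a, ha, hlim.congr fun n => (hab n).symm⟩

end FormSpace

/-! ### Cores and uniqueness of the closed form -/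

theorem IsFormOf.form_eq_of_mem {h h' : SesqForm E} {H : Submodule ℂ (E × E)}
    (hh : IsFormOf h H) (hh' : IsFormOf h' H) {p : E × E} (hp : p ∈ H)
    (h1 : p.1 ∈ h.domain) (h1' : p.1 ∈ h'.domain) {k : E} (h2 : k ∈ h.domain)
    (h2' : k ∈ h'.domain) : h.form ⟨p.1, h1⟩ ⟨k, h2⟩ = h'.form ⟨p.1, h1'⟩ ⟨k, h2'⟩ := by
  obtain ⟨_, e⟩ := hh.repr p hp
  obtain ⟨_, e'⟩ := hh'.repr p hp
  exact (e ⟨k, h2⟩).trans (e' ⟨k, h2'⟩).symm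

variable [CompleteSpace E]

/-- The domain of a nonnegative selfadjoint relation is a core of its form. -/
theorem IsFormOf.exists_tendsto {h : SesqForm E} {H : Submodule ℂ (E × E)}
    (hH : IsNonnegSelfAdjoint H) (hh : IsFormOf h H) (x : h.domain) :
    ∃ (p : ℕ → E × E) (hp : ∀ n, (p n).1 ∈ h.domain), (∀ n, p n ∈ H) ∧
      Tendsto (fun n => FormSpace.equiv h hh.nonneg ⟨(p n).1, hp n⟩) atTop
        (𝓝 (FormSpace.equiv h hh.nonneg x)) := by
  obtain ⟨R, hR, -⟩ := hH.exists_resolvent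
  let M : Submodule ℂ h.domain := (H.map (LinearMap.fst ℂ E E)).comap h.domain.subtype
  obtain ⟨a, ha, hlim⟩ := FormSpace.exists_tendsto_of_orthogonal hh.nonneg hh.closed M (by
    intro k hk
    -- With R = (H + I)⁻¹, the pair (Rk, k - Rk) lies in H, so h[Rk, k] + (Rk, k) = (k, k):
    -- orthogonality to Rk alone forces k = 0.
    obtain ⟨hp, hrep⟩ := hh.repr _ (hR k)
    have h1 := hk ⟨R k, hp⟩ ⟨_, hR k, rfl⟩
    have h2 := hrep k
    simp only at h2
    rw [h2, ← inner_add_right, sub_add_cancel] at h1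
    exact Subtype.ext (inner_self_eq_zero.1 h1)) x
  choose p hp hpa using ha
  have hpa' : ∀ n, (p n).1 = a n := hpa
  have hpd : ∀ n, (p n).1 ∈ h.domain := fun n => by rw [hpa']; exact (a n).2
  exact ⟨p, hpd, hp, hlim.congr fun n => congrArg _ (Subtype.ext (hpa' n).symm)⟩

/-- Both forms agree on dom H. A sequence from dom H converging to x in the norm of h is therefore
Cauchy for h', and closedness of h' captures x; the values agree in the limit. -/
theorem IsFormOf.exists_form_eq {h h' : SesqForm E} {H : Submodule ℂ (E × E)}
    (hH : IsNonnegSelfAdjoint H) (hh : IsFormOf h H) (hh' : IsFormOf h' H) (x : h.domain) :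
    ∃ hx : (x : E) ∈ h'.domain, ∀ (k : h.domain) (hk : (k : E) ∈ h'.domain),
      h.form x k = h'.form ⟨x, hx⟩ ⟨k, hk⟩ := by
  obtain ⟨p, hp, hpH, hlim⟩ := hh.exists_tendsto hH x
  have hp' : ∀ n, (p n).1 ∈ h'.domain := fun n => (hh'.repr _ (hpH n)).1
  have hE := ((FormSpace.embed h hh.nonneg).continuous.tendsto _).comp hlim
  obtain ⟨hx, hx'⟩ := hh'.closed (fun n => ⟨(p n).1, hp' n⟩) x hE (by
    refine (FormSpace.tendsto_form_sub hlim.cauchySeq).congr fun q => ?_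
    exact hh.form_eq_of_mem hh' (H.sub_mem (hpH q.1) (hpH q.2)) _ _ _ _)
  refine ⟨hx, fun k hk => tendsto_nhds_unique (FormSpace.tendsto_form_left hlim k) ?_⟩
  have h1 := FormSpace.tendsto_form_left (FormSpace.tendsto_equiv (hn := hh'.nonneg)
    (x := ⟨x, hx⟩) hE hx') ⟨k, hk⟩
  exact h1.congr fun n => (hh.form_eq_of_mem hh' (hpH n) _ _ _ _).symm

/-- The closed form of a nonnegative selfadjoint relation is unique. -/
theorem IsFormOf.domain_eq {h h' : SesqForm E} {H : Submodule ℂ (E × E)}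
    (hH : IsNonnegSelfAdjoint H) (hh : IsFormOf h H) (hh' : IsFormOf h' H) :
    h.domain = h'.domain :=
  le_antisymm (fun x hx => (hh.exists_form_eq hH hh' ⟨x, hx⟩).1)
    fun x hx => (hh'.exists_form_eq hH hh ⟨x, hx⟩).1

theorem IsFormOf.form_eq {h h' : SesqForm E} {H : Submodule ℂ (E × E)}
    (hH : IsNonnegSelfAdjoint H) (hh : IsFormOf h H) (hh' : IsFormOf h' H) {x k : E}
    (hx : x ∈ h.domain) (hk : k ∈ h.domain) (hx' : x ∈ h'.domain) (hk' : k ∈ h'.domain) :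
    h.form ⟨x, hx⟩ ⟨k, hk⟩ = h'.form ⟨x, hx'⟩ ⟨k, hk'⟩ :=
  (hh.exists_form_eq hH hh' ⟨x, hx⟩).2 ⟨k, hk⟩ hk'

/-! ### The form of an operator through its square root -/

/-- The form `(T u, T v)` of a selfadjoint square root `T` of `A` is the closed form of `A`. -/
theorem IsSqrt.exists_isFormOf {T A : E →ₗ.[ℂ] E} (hT : IsSqrt T A) :
    ∃ h : SesqForm E, IsFormOf h A.graph ∧ ∃ e : h.domain = T.domain,
      ∀ u v : h.domain, h.form u v = inner ℂ (T ⟨v, e ▸ v.2⟩) (T ⟨u, e ▸ u.2⟩) := by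
  let h : SesqForm E :=
    { domain := T.domain
      form := LinearMap.mk₂'ₛₗ (RingHom.id ℂ) (starRingEnd ℂ) (fun u v => inner ℂ (T v) (T u))
        (fun u u' v => by rw [T.map_add, inner_add_right])
        (fun c u v => by rw [T.map_smul, inner_smul_right]; rfl)
        (fun u v v' => by rw [T.map_add, inner_add_left])
        (fun c u v => by rw [T.map_smul, inner_smul_left]; rfl) }
  have hform : ∀ u v : T.domain, h.form u v = inner ℂ (T v) (T u) := fun u v => rfl
  have hself : ∀ u : T.domain, h.form u u = ((‖T u‖ ^ 2 : ℝ) : ℂ) := fun u => by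
    rw [hform, inner_self_eq_norm_sq_to_K]; push_cast; rfl
  refine ⟨h, ⟨fun u => ?_, fun a x hx ha => ?_, fun r hr => ?_⟩, rfl, fun u v => rfl⟩
  · rw [hself]
    exact Complex.zero_le_real.2 (sq_nonneg _)
  · have hcau : CauchySeq fun n => T (a n) := by
      rw [cauchySeq_iff_tendsto_dist_atTop_0]
      have h1 := ((Complex.continuous_re.tendsto 0).comp ha).sqrt
      rw [Complex.zero_re, Real.sqrt_zero] at h1
      refine h1.congr fun t => ?_
      rw [Function.comp_apply, hself, Complex.ofReal_re, Real.sqrt_sq (norm_nonneg _),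
        dist_eq_norm, ← T.map_sub]
    obtain ⟨y, hy⟩ := cauchySeq_tendsto_of_complete hcau
    -- Closedness of the form is closedness of the selfadjoint operator T.
    have hcl : IsClosed (T.graph : Set (E × E)) := hT.selfAdjoint.isClosed
    have hg : (x, y) ∈ T.graph :=
      hcl.mem_of_tendsto (hx.prodMk_nhds hy) (Eventually.of_forall fun n => T.mem_graph (a n))
    obtain ⟨z, hz, hzy⟩ := T.mem_graph_iff.1 hg
    simp only at hz hzy
    subst hz
    refine ⟨z.2, ?_⟩
    have h1 : Tendsto (fun n => T (a n - z)) atTop (𝓝 0) := by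
      simp only [T.map_sub, hzy]
      simpa using hy.sub_const y
    have h3 := h1.inner (𝕜 := ℂ) h1
    rw [inner_zero_left] at h3
    exact h3
  · obtain ⟨z, hz1, hz2⟩ := (hT.comp_eq r.1 r.2).1 hr
    obtain ⟨u, hu, rfl⟩ := T.mem_graph_iff.1 hz1
    obtain ⟨w, hw, hw2⟩ := T.mem_graph_iff.1 hz2
    simp only at hu hw hw2
    have hr1 : r.1 ∈ T.domain := hu ▸ u.2
    have hu' : u = ⟨r.1, hr1⟩ := Subtype.ext hu
    refine ⟨hr1, fun k => ?_⟩
    refine (hform _ _).trans ?_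
    have hsym := LinearPMap.adjoint_isFormalAdjoint hT.selfAdjoint.dense_domain
    rw [LinearPMap.isSelfAdjoint_def.1 hT.selfAdjoint] at hsym
    rw [← hu', ← hw, hsym k w, hw2]

theorem opSqrt_domain {A : E →ₗ.[ℂ] E} (hA : IsSelfAdjoint A) (h : IsNonneg A) :
    (opSqrt A).domain = formDomain A := by
  obtain ⟨f, hf, e, -⟩ := (opSqrt_spec hA h).exists_isFormOf
  rw [← e]
  have hg := isNonnegSelfAdjoint_graph hA h
  exact hf.domain_eq hg (closedForm_spec hg)

theorem opForm_eq_inner_opSqrt {A : E →ₗ.[ℂ] E} (hA : IsSelfAdjoint A) (h : IsNonneg A)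
    (u v : formDomain A) (hu : (u : E) ∈ (opSqrt A).domain) (hv : (v : E) ∈ (opSqrt A).domain) :
    opForm A u v = inner ℂ (opSqrt A ⟨v, hv⟩) (opSqrt A ⟨u, hu⟩) := by
  obtain ⟨f, hf, e, he⟩ := (opSqrt_spec hA h).exists_isFormOf
  have hg := isNonnegSelfAdjoint_graph hA h
  rw [← he ⟨u, e ▸ hu⟩ ⟨v, e ▸ hv⟩]
  exact (closedForm_spec hg).form_eq hg hf _ _ _ _

/-! ### A criterion for selfadjointness -/

/-- A symmetric nonnegative operator `A` for which `A + I` is surjective is selfadjoint. -/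
theorem isSelfAdjoint_of_surjective {A : E →ₗ.[ℂ] E} (hsym : A.IsFormalAdjoint A)
    (hsurj : ∀ y : E, ∃ u : A.domain, A u + u = y) : IsSelfAdjoint A := by
  have hgr : ∀ r : E × E, r ∈ A.graph.adjoint → r ∈ A.graph := fun r hr => by
    rw [Submodule.mem_adjoint_iff] at hr
    obtain ⟨u, hu⟩ := hsurj (r.1 + r.2)
    -- Since r.2 - Au = -(r.1 - u) and both (u, Au) and r lie in the adjoint relation, r.1 - u is
    -- orthogonal to ran(A + I), which is the whole space.
    have h1 : r.1 - u = 0 := by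
      obtain ⟨w, hw⟩ := hsurj (r.1 - u)
      have h2 := hr w (A w) (A.mem_graph w)
      have h3 := hsym w u
      have h4 : r.2 = A u + u - r.1 := by rw [hu]; abel
      rw [← inner_self_eq_zero (𝕜 := ℂ)]
      nth_rewrite 1 [← hw]
      rw [h4] at h2
      simp only [inner_add_left, inner_sub_right, inner_add_right] at h2 ⊢
      linear_combination h2 - h3
    rw [sub_eq_zero] at h1
    rw [LinearPMap.mem_graph_iff]
    exact ⟨u, h1.symm, by rw [← h1, add_comm] at hu; exact add_left_cancel hu⟩
  have hdense : Dense (A.domain : Set E) := by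
    rw [Submodule.dense_iff_topologicalClosure_eq_top,
      Submodule.topologicalClosure_eq_top_iff, eq_bot_iff]
    intro y hy
    rw [Submodule.mem_orthogonal] at hy
    -- Density comes for free: if y ⟂ dom A, then (0, y) is in the adjoint relation, hence in the
    -- graph of A.
    refine A.graph_fst_eq_zero_snd (hgr (0, y) ?_) rfl
    rw [Submodule.mem_adjoint_iff]
    intro a b hab
    rw [inner_zero_right, hy a (LinearPMap.mem_domain_of_mem_graph hab), sub_zero]
  rw [LinearPMap.isSelfAdjoint_def]
  refine le_antisymm (LinearPMap.le_of_le_graph ?_) (hsym.le_adjoint hdense)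
  rw [LinearPMap.adjoint_graph_eq_graph_adjoint hdense]
  exact hgr

end FormSpaces
end NonnegExt
end

noncomputable section

namespace NonnegExt

section MainTransform

variable {E : Type*} [NormedAddCommGroup E] [InnerProductSpace ℂ E]
variable {K : Type*} [NormedAddCommGroup K] [InnerProductSpace ℂ K]
variable {S S₀ S₁ : E →ₗ.[ℂ] E}

theorem mem_relInv {H : Submodule ℂ (E × E)} {r : E × E} : r ∈ relInv H ↔ (r.2, r.1) ∈ H := by
  constructor
  · rintro ⟨s, hs, rfl⟩
    exact hs
  · exact fun hr => ⟨_, hr, rfl⟩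

/-! ### The form on the graph of Γ₀ -/

/-- The form `S₁[u, v]` on the pairs `(u, Γ₀ u)`, `u ∈ D[S₁]`. -/
def transformForm (S₁ : E →ₗ.[ℂ] E) (Γ₀ : formDomain S₁ →ₗ[ℂ] K) :
    SesqForm (WithLp 2 (E × K)) :=
  let D : Submodule ℂ (WithLp 2 (E × K)) :=
    { carrier := {x | ∃ hD : x.fst ∈ formDomain S₁, Γ₀ ⟨x.fst, hD⟩ = x.snd}
      zero_mem' := ⟨zero_mem _, map_zero Γ₀⟩
      add_mem' := by
        rintro a b ⟨ha, ea⟩ ⟨hb, eb⟩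
        refine ⟨add_mem ha hb, ?_⟩
        rw [WithLp.add_snd, ← ea, ← eb, ← map_add]; rfl
      smul_mem' := by
        rintro c a ⟨ha, ea⟩
        refine ⟨Submodule.smul_mem _ c ha, ?_⟩
        rw [WithLp.smul_snd, ← ea, ← map_smul]; rfl }
  let r : D →ₗ[ℂ] formDomain S₁ :=
    { toFun := fun x => ⟨x.1.fst, x.2.1⟩
      map_add' := fun _ _ => rfl
      map_smul' := fun _ _ => rfl }
  ⟨D, ((opForm S₁).comp r).compl₂ r⟩

variable {Γ₀ : formDomain S₁ →ₗ[ℂ] K}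

theorem transformForm_apply (x y : (transformForm S₁ Γ₀).domain) :
    (transformForm S₁ Γ₀).form x y =
      opForm S₁ ⟨x.1.fst, x.2.1⟩ ⟨y.1.fst, y.2.1⟩ := rfl

variable [CompleteSpace E]

theorem isFormOf_closedForm_graph {T : E →ₗ.[ℂ] E} (hT : IsSelfAdjoint T) (h : IsNonneg T) :
    IsFormOf (closedForm T.graph) T.graph :=
  closedForm_spec (isNonnegSelfAdjoint_graph hT h)

theorem domain_le_formDomain {T : E →ₗ.[ℂ] E} (hT : IsSelfAdjoint T) (h : IsNonneg T) :
    T.domain ≤ formDomain T := fun x hx =>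
  ((isFormOf_closedForm_graph hT h).repr _ (T.mem_graph ⟨x, hx⟩)).1

theorem opForm_apply {T : E →ₗ.[ℂ] E} (hT : IsSelfAdjoint T) (h : IsNonneg T) (u : T.domain)
    (hu : (u : E) ∈ formDomain T) (k : formDomain T) :
    opForm T ⟨u, hu⟩ k = inner ℂ (k : E) (T u) :=
  ((isFormOf_closedForm_graph hT h).repr _ (T.mem_graph u)).2 k

theorem isFormalAdjoint_self {T : E →ₗ.[ℂ] E} (hT : IsSelfAdjoint T) : T.IsFormalAdjoint T := by
  have h := LinearPMap.adjoint_isFormalAdjoint hT.dense_domain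
  rwa [LinearPMap.isSelfAdjoint_def.1 hT] at h

/-- A selfadjoint extension of `S` is a restriction of the adjoint of `S`. -/
theorem le_adjoint_of_le {T : E →ₗ.[ℂ] E} (hS : Dense (S.domain : Set E)) (hT : IsSelfAdjoint T)
    (h : S ≤ T) : T ≤ S† := by
  refine LinearPMap.IsFormalAdjoint.le_adjoint hS fun x y => ?_
  rw [LinearPMap.apply_comp_inclusion h x]
  exact isFormalAdjoint_self hT _ y

/-! ### The manifold L inside D[S₁] and dom S* -/

namespace IsExtensionPair

theorem formDomain_le (hS : IsExtensionPair S S₀ S₁) : formDomain S₀ ≤ formDomain S₁ :=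
  hS.form_restriction.2.1

theorem opForm_eq (hS : IsExtensionPair S S₀ S₁) {u v : E} (hu : u ∈ formDomain S₀)
    (hv : v ∈ formDomain S₀) (hu' : u ∈ formDomain S₁) (hv' : v ∈ formDomain S₁) :
    opForm S₀ ⟨u, hu⟩ ⟨v, hv⟩ = opForm S₁ ⟨u, hu'⟩ ⟨v, hv'⟩ :=
  hS.form_restriction.2.2 ⟨u, hu⟩ ⟨v, hv⟩

theorem nonneg_form (hS : IsExtensionPair S S₀ S₁) : (closedForm S₁.graph).Nonneg :=
  (isFormOf_closedForm_graph hS.selfAdjoint₁ hS.nonneg₁).nonneg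

/-- For x ∈ dom S ⊂ D[S₀] one has S₁[x, g] = (Sx, g), so orthogonality of g to x in D[S₁] is the
weak form of S*g = -g. -/
theorem formComplement_inner (hS : IsExtensionPair S S₀ S₁) {g : E}
    (hg : g ∈ formComplement S₀ S₁) (x : S.domain) :
    inner ℂ (-g) (x : E) = inner ℂ g (S x) := by
  obtain ⟨hgD, hg⟩ := hg
  have hx₀ : (x : E) ∈ formDomain S₀ :=
    domain_le_formDomain hS.selfAdjoint₀ hS.nonneg₀ (hS.le₀.1 x.2)
  have h1 := hg ⟨x, hS.formDomain_le hx₀⟩ hx₀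
  have h2 := opForm_apply hS.selfAdjoint₁ hS.nonneg₁ ⟨x, hS.le₁.1 x.2⟩
    (hS.formDomain_le hx₀) ⟨g, hgD⟩
  have h3 : S₁ ⟨x, hS.le₁.1 x.2⟩ = S x := (LinearPMap.apply_comp_inclusion hS.le₁ x).symm
  rw [h3, ← hS.nonneg_form.conj_form] at h2
  have h4 := congrArg (starRingEnd ℂ) h1
  rw [map_add, inner_conj_symm, map_zero] at h4
  have h5 : inner ℂ g (S x) = starRingEnd ℂ
      (opForm S₁ ⟨g, hgD⟩ ⟨x, hS.formDomain_le hx₀⟩) := h2.symm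
  rw [inner_neg_left, h5]
  linear_combination -h4

theorem formComplement_le_adjoint_domain (hS : IsExtensionPair S S₀ S₁) :
    formComplement S₀ S₁ ≤ S†.domain := fun _ hg =>
  LinearPMap.mem_adjoint_domain_of_exists _ ⟨_, hS.formComplement_inner hg⟩

theorem adjoint_apply_of_mem_formComplement (hS : IsExtensionPair S S₀ S₁) {g : E}
    (hg : g ∈ formComplement S₀ S₁) (hg' : g ∈ S†.domain) : S† ⟨g, hg'⟩ = -g :=
  LinearPMap.adjoint_apply_eq hS.dense _ (hS.formComplement_inner hg)

theorem boundaryDomain_le (hS : IsExtensionPair S S₀ S₁) :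
    boundaryDomain S₀ S₁ ≤ formDomain S₁ ⊓ S†.domain := by
  refine sup_le (le_inf ?_ ?_) (le_inf ?_ hS.formComplement_le_adjoint_domain)
  · exact (domain_le_formDomain hS.selfAdjoint₀ hS.nonneg₀).trans hS.formDomain_le
  · exact (le_adjoint_of_le hS.dense hS.selfAdjoint₀ hS.le₀).1
  · rintro g ⟨hg, -⟩
    exact hg

end IsExtensionPair

/-! ### The transform represents its form -/

theorem transformForm_nonneg (hS : IsExtensionPair S S₀ S₁) : (transformForm S₁ Γ₀).Nonneg :=
  fun _ => hS.nonneg_form _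

/-- Closedness of S₁[·,·] handles the first components; boundedness of Γ₀ in the norm of D[S₁] then
keeps the limit on the graph of Γ₀. -/
theorem transformForm_closed (hS : IsExtensionPair S S₀ S₁) (hΓ : IsBoundaryPair S₀ S₁ Γ₀) :
    (transformForm S₁ Γ₀).Closed := by
  intro a x hx ha
  have hfst : Tendsto (fun n => (a n).1.fst) atTop (𝓝 x.fst) :=
    ((WithLp.fstL 2 ℂ E K).continuous.tendsto _).comp hx
  have hsnd : Tendsto (fun n => (a n).1.snd) atTop (𝓝 x.snd) :=
    ((WithLp.sndL 2 ℂ E K).continuous.tendsto _).comp hx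
  obtain ⟨hD, hlim⟩ := (isFormOf_closedForm_graph hS.selfAdjoint₁ hS.nonneg₁).closed
    (fun n => ⟨(a n).1.fst, (a n).2.1⟩) x.fst hfst ha
  have heq : Γ₀ ⟨x.fst, hD⟩ = x.snd := by
    obtain ⟨C, hC⟩ := hΓ.bounded
    refine tendsto_nhds_unique ?_ hsnd
    rw [tendsto_iff_norm_sub_tendsto_zero]
    have h1 := FormSpace.tendsto_equiv (hn := hS.nonneg_form) (x := ⟨x.fst, hD⟩) hfst hlim
    have h2 := (tendsto_iff_norm_sub_tendsto_zero.1 h1).const_mul C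
    rw [mul_zero] at h2
    refine squeeze_zero (fun _ => norm_nonneg _) (fun n => ?_) h2
    rw [← (a n).2.2, ← map_sub, ← map_sub, FormSpace.norm_equiv]
    exact hC _
  exact ⟨⟨hD, heq⟩, hlim⟩

variable {Γ₁ : boundaryDomain S₀ S₁ →ₗ[ℂ] K}

theorem mainTransform_apply (x : (mainTransform S S₀ S₁ Γ₀ Γ₁).domain) :
    mainTransform S S₀ S₁ Γ₀ Γ₁ x =
      WithLp.toLp 2 (S† ⟨x.1.fst, x.2.2.1⟩, -Γ₁ ⟨x.1.fst, x.2.1⟩) := rfl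

/-- Green's identity expresses the transform through the form. -/
theorem inner_mainTransform (hΓ : IsBoundaryTriplet S S₀ S₁ Γ₀ Γ₁)
    (x : (mainTransform S S₀ S₁ Γ₀ Γ₁).domain) (v : formDomain S₁) :
    inner ℂ (WithLp.toLp 2 ((v : E), Γ₀ v)) (mainTransform S S₀ S₁ Γ₀ Γ₁ x) =
      opForm S₁ ⟨x.1.fst, x.2.2.2.1⟩ v := by
  have h1 := hΓ.green ⟨x.1.fst, x.2.1⟩ x.2.2.2.1 x.2.2.1 v
  rw [h1, mainTransform_apply, WithLp.prod_inner_apply]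
  simp only [inner_neg_right]
  ring

theorem inner_mainTransform' (hΓ : IsBoundaryTriplet S S₀ S₁ Γ₀ Γ₁)
    (x : (mainTransform S S₀ S₁ Γ₀ Γ₁).domain) {y : WithLp 2 (E × K)}
    (hy : y.fst ∈ formDomain S₁) (hy' : Γ₀ ⟨y.fst, hy⟩ = y.snd) :
    inner ℂ y (mainTransform S S₀ S₁ Γ₀ Γ₁ x) =
      opForm S₁ ⟨x.1.fst, x.2.2.2.1⟩ ⟨y.fst, hy⟩ := by
  rw [← inner_mainTransform hΓ x ⟨y.fst, hy⟩, hy']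
  rfl

theorem mainTransform_nonneg (hS : IsExtensionPair S S₀ S₁)
    (hΓ : IsBoundaryTriplet S S₀ S₁ Γ₀ Γ₁) : IsNonneg (mainTransform S S₀ S₁ Γ₀ Γ₁) := fun x => by
  rw [inner_mainTransform' hΓ x x.2.2.2.1 x.2.2.2.2]
  exact hS.nonneg_form _

theorem mainTransform_symm (hS : IsExtensionPair S S₀ S₁)
    (hΓ : IsBoundaryTriplet S S₀ S₁ Γ₀ Γ₁) :
    (mainTransform S S₀ S₁ Γ₀ Γ₁).IsFormalAdjoint (mainTransform S S₀ S₁ Γ₀ Γ₁) := fun x y => by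
  rw [inner_mainTransform' hΓ y x.2.2.2.1 x.2.2.2.2, ← inner_conj_symm,
    inner_mainTransform' hΓ x y.2.2.2.1 y.2.2.2.2]
  exact hS.nonneg_form.conj_form _ _

theorem mainTransform_extends (hS : IsExtensionPair S S₀ S₁)
    (hΓ : IsBoundaryTriplet S S₀ S₁ Γ₀ Γ₁) (u : S.domain) :
    ∃ hu : WithLp.toLp 2 ((u : E), (0 : K)) ∈ (mainTransform S S₀ S₁ Γ₀ Γ₁).domain,
      mainTransform S S₀ S₁ Γ₀ Γ₁ ⟨_, hu⟩ = WithLp.toLp 2 (S u, 0) := by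
  have hu₀ : (u : E) ∈ formDomain S₀ :=
    domain_le_formDomain hS.selfAdjoint₀ hS.nonneg₀ (hS.le₀.1 u.2)
  have huD := hS.formDomain_le hu₀
  have huL : (u : E) ∈ boundaryDomain S₀ S₁ := Submodule.mem_sup_left (hS.le₀.1 u.2)
  have huS : (u : E) ∈ S†.domain := (hS.boundaryDomain_le huL).2
  have hSu : S† ⟨u, huS⟩ = S u :=
    (LinearPMap.apply_comp_inclusion (hS.symm.le_adjoint hS.dense) u).symm
  -- On dom S, S₁[u, v] = (Su, v) for all v ∈ D[S₁], so the boundary term in Green's identity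
  -- vanishes against all of ran Γ₀ = K.
  have hΓu : Γ₁ ⟨u, huL⟩ = 0 := by
    refine ext_inner_left ℂ fun k => ?_
    obtain ⟨v, rfl⟩ := hΓ.surjective k
    have h1 := hΓ.green ⟨u, huL⟩ huD huS v
    have h2 := opForm_apply hS.selfAdjoint₁ hS.nonneg₁ ⟨u, hS.le₁.1 u.2⟩ huD v
    have h3 : S₁ ⟨u, hS.le₁.1 u.2⟩ = S u := (LinearPMap.apply_comp_inclusion hS.le₁ u).symm
    rw [h3] at h2
    rw [hSu] at h1
    rw [inner_zero_right]
    linear_combination h1 - h2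
  refine ⟨⟨huL, huS, huD, (hΓ.ker _).2 hu₀⟩, ?_⟩
  rw [mainTransform_apply]
  exact (WithLp.ofLp_injective 2) (Prod.ext hSu (by simpa using hΓu))

theorem isFormOf_transformForm (hS : IsExtensionPair S S₀ S₁)
    (hΓ : IsBoundaryTriplet S S₀ S₁ Γ₀ Γ₁) :
    IsFormOf (transformForm S₁ Γ₀) (mainTransform S S₀ S₁ Γ₀ Γ₁).graph := by
  refine ⟨transformForm_nonneg hS, transformForm_closed hS hΓ.toIsBoundaryPair, fun p hp => ?_⟩
  obtain ⟨x, h1, h2⟩ := (LinearPMap.mem_graph_iff _).1 hp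
  rw [← h1, ← h2]
  exact ⟨x.2.2.2, fun k => (inner_mainTransform' hΓ x k.2.1 k.2.2).symm⟩

/-! ### Selfadjointness and the form of the transform -/

variable [CompleteSpace K]

/-- A variational argument: Riesz yields a weak solution in the form domain, and its regularity, u ∈
L, comes from subtracting (S₀ + I)⁻¹ of the first component of y. -/
theorem mainTransform_add_self_surjective (hS : IsExtensionPair S S₀ S₁)
    (hΓ : IsBoundaryTriplet S S₀ S₁ Γ₀ Γ₁) (y : WithLp 2 (E × K)) :
    ∃ x : (mainTransform S S₀ S₁ Γ₀ Γ₁).domain, mainTransform S S₀ S₁ Γ₀ Γ₁ x + x = y := by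
  have hn : (transformForm S₁ Γ₀).Nonneg := transformForm_nonneg hS
  let l : (transformForm S₁ Γ₀).domain →ₗ⋆[ℂ] ℂ :=
    { toFun := fun v => inner ℂ (v : WithLp 2 (E × K)) y
      map_add' := fun u v => by rw [Submodule.coe_add, inner_add_left]
      map_smul' := fun c v => by rw [Submodule.coe_smul, inner_smul_left]; rfl }
  obtain ⟨u, hu⟩ := FormSpace.exists_riesz hn
    (transformForm_closed hS hΓ.toIsBoundaryPair) l ‖y‖ fun v => by
      rw [← FormSpace.norm_equiv (hn := hn), mul_comm]
      exact (norm_inner_le_norm _ _).trans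
        (mul_le_mul_of_nonneg_right (FormSpace.norm_coe_le v) (norm_nonneg _))
  have huD := u.2.1
  have hu' : ∀ v : formDomain S₁, opForm S₁ ⟨u.1.fst, huD⟩ v + inner ℂ (v : E) u.1.fst +
      inner ℂ (Γ₀ v) u.1.snd = inner ℂ (v : E) y.fst + inner ℂ (Γ₀ v) y.snd := fun v => by
    have h1 := hu ⟨WithLp.toLp 2 ((v : E), Γ₀ v), v.2, rfl⟩
    change _ = inner ℂ (WithLp.toLp 2 ((v : E), Γ₀ v)) y at h1
    rw [transformForm_apply, WithLp.prod_inner_apply, WithLp.prod_inner_apply, ← add_assoc] at h1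
    exact h1
  -- split off the solution of the problem for `S₀`
  have hg₀ := isNonnegSelfAdjoint_graph hS.selfAdjoint₀ hS.nonneg₀
  obtain ⟨R, hR, -⟩ := hg₀.exists_resolvent
  obtain ⟨w, hw1, hw2⟩ := S₀.mem_graph_iff.1 (hR y.fst)
  simp only at hw1 hw2
  have hw₀ : (w : E) ∈ formDomain S₀ := domain_le_formDomain hS.selfAdjoint₀ hS.nonneg₀ w.2
  have hw₁ : (w : E) ∈ formDomain S₁ := hS.formDomain_le hw₀
  -- For f ∈ D[S₀] the terms with Γ₀f drop out, so u and w = (S₀ + I)⁻¹y₁ satisfy the same weak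
  -- equation against f.
  have hg : u.1.fst - w ∈ formComplement S₀ S₁ := by
    refine ⟨sub_mem huD hw₁, fun f hf => ?_⟩
    have h1 := hu' f
    rw [(hΓ.ker f).2 hf, inner_zero_left, inner_zero_left, add_zero, add_zero] at h1
    have h2 := opForm_apply hS.selfAdjoint₀ hS.nonneg₀ w hw₀ ⟨f, hf⟩
    rw [hS.opForm_eq hw₀ hf hw₁ f.2, hw2, ← hw1, inner_sub_right] at h2
    have h3 : (⟨u.1.fst - w, sub_mem huD hw₁⟩ : formDomain S₁) =
        ⟨u.1.fst, huD⟩ - ⟨w, hw₁⟩ := rfl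
    rw [h3, map_sub, LinearMap.sub_apply, inner_sub_right]
    linear_combination h1 - h2
  have huL : u.1.fst ∈ boundaryDomain S₀ S₁ := by
    rw [← add_sub_cancel (w : E) u.1.fst]
    exact add_mem (Submodule.mem_sup_left w.2) (Submodule.mem_sup_right hg)
  have huS : u.1.fst ∈ S†.domain := (hS.boundaryDomain_le huL).2
  have hle := le_adjoint_of_le hS.dense hS.selfAdjoint₀ hS.le₀
  have hSu : S† ⟨u.1.fst, huS⟩ + u.1.fst = y.fst := by
    have hgS := hS.formComplement_le_adjoint_domain hg
    have h1 : (⟨u.1.fst, huS⟩ : S†.domain) = ⟨w, hle.1 w.2⟩ + ⟨u.1.fst - w, hgS⟩ :=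
      Subtype.ext (add_sub_cancel (w : E) u.1.fst).symm
    have h2 : S† ⟨w, hle.1 w.2⟩ = S₀ w := (LinearPMap.apply_comp_inclusion hle w).symm
    rw [h1, LinearPMap.map_add, h2, hS.adjoint_apply_of_mem_formComplement hg hgS, hw2, ← hw1]
    abel
  -- Once the equation in `E` is cancelled by Green's identity, the weak equation leaves only terms
  -- paired with Γ₀v, and these exhaust K.
  have hΓu : -Γ₁ ⟨u.1.fst, huL⟩ + u.1.snd = y.snd := by
    refine ext_inner_left ℂ fun k => ?_
    obtain ⟨v, rfl⟩ := hΓ.surjective k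
    have h1 := hΓ.green ⟨u.1.fst, huL⟩ huD huS v
    have h2 := hu' v
    rw [h1, ← hSu, inner_add_right] at h2
    rw [inner_add_right, inner_neg_right]
    linear_combination h2
  refine ⟨⟨u.1, huL, huS, huD, u.2.2⟩, ?_⟩
  rw [mainTransform_apply]
  exact (WithLp.ofLp_injective 2) (Prod.ext hSu hΓu)

theorem mainTransform_isSelfAdjoint (hS : IsExtensionPair S S₀ S₁)
    (hΓ : IsBoundaryTriplet S S₀ S₁ Γ₀ Γ₁) : IsSelfAdjoint (mainTransform S S₀ S₁ Γ₀ Γ₁) :=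
  isSelfAdjoint_of_surjective (mainTransform_symm hS hΓ) (mainTransform_add_self_surjective hS hΓ)

theorem mem_formDomain_mainTransform (hS : IsExtensionPair S S₀ S₁)
    (hΓ : IsBoundaryTriplet S S₀ S₁ Γ₀ Γ₁) {x : WithLp 2 (E × K)} :
    x ∈ formDomain (mainTransform S S₀ S₁ Γ₀ Γ₁) ↔
      ∃ hD : x.fst ∈ formDomain S₁, Γ₀ ⟨x.fst, hD⟩ = x.snd := by
  have hg := isNonnegSelfAdjoint_graph (mainTransform_isSelfAdjoint hS hΓ)
    (mainTransform_nonneg hS hΓ)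
  rw [formDomain, (closedForm_spec hg).domain_eq hg (isFormOf_transformForm hS hΓ)]
  rfl

theorem opForm_mainTransform (hS : IsExtensionPair S S₀ S₁)
    (hΓ : IsBoundaryTriplet S S₀ S₁ Γ₀ Γ₁) {x y : WithLp 2 (E × K)}
    (hx : x ∈ formDomain (mainTransform S S₀ S₁ Γ₀ Γ₁))
    (hy : y ∈ formDomain (mainTransform S S₀ S₁ Γ₀ Γ₁))
    (hx' : x.fst ∈ formDomain S₁) (hy' : y.fst ∈ formDomain S₁) :
    opForm (mainTransform S S₀ S₁ Γ₀ Γ₁) ⟨x, hx⟩ ⟨y, hy⟩ =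
      opForm S₁ ⟨x.fst, hx'⟩ ⟨y.fst, hy'⟩ := by
  have hg := isNonnegSelfAdjoint_graph (mainTransform_isSelfAdjoint hS hΓ)
    (mainTransform_nonneg hS hΓ)
  exact (closedForm_spec hg).form_eq hg (isFormOf_transformForm hS hΓ) hx hy
    ((mem_formDomain_mainTransform hS hΓ).1 hx) ((mem_formDomain_mainTransform hS hΓ).1 hy)

/-! ### Approximation by dom S₀ in the form of S₁ -/

/-- If the form of `S₁⁻¹` is a closed restriction of that of `S₀⁻¹`, then elements of `dom S₁`
are approximated by elements of `dom S₀` with respect to the form of `S₁`. -/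
theorem IsExtensionPair.exists_opForm_sub_lt_of_mem_domain (hS : IsExtensionPair S S₀ S₁)
    (hinv : (closedForm (relInv S₁.graph)).IsClosedRestriction (closedForm (relInv S₀.graph)))
    (f : S₁.domain) (hf : (f : E) ∈ formDomain S₁) {ε : ℝ} (hε : 0 < ε) :
    ∃ (k : S₀.domain) (hk : (k : E) ∈ formDomain S₁),
      (opForm S₁ (⟨f, hf⟩ - ⟨k, hk⟩) (⟨f, hf⟩ - ⟨k, hk⟩)).re < ε := by
  have hr₀ := (isNonnegSelfAdjoint_graph hS.selfAdjoint₀ hS.nonneg₀).relInv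
  have hr₁ := (isNonnegSelfAdjoint_graph hS.selfAdjoint₁ hS.nonneg₁).relInv
  have hF₀ := closedForm_spec hr₀
  have hF₁ := closedForm_spec hr₁
  set g : E := S₁ f with hg
  obtain ⟨hg₁, hgrep⟩ := hF₁.repr (g, (f : E)) (mem_relInv.2 (S₁.mem_graph f))
  obtain ⟨-, hle, hres⟩ := hinv
  have hg₀ := hle hg₁
  -- The condition on the inverses enters here: S₀⁻¹[g] = S₁⁻¹[g] = (f, g) for g = S₁f.
  have hgg : (closedForm (relInv S₀.graph)).form ⟨g, hg₀⟩ ⟨g, hg₀⟩ = inner ℂ g (f : E) :=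
    (hres ⟨g, hg₁⟩ ⟨g, hg₁⟩).symm.trans (hgrep ⟨g, hg₁⟩)
  obtain ⟨p, hp, hpH, hlim⟩ := hF₀.exists_tendsto hr₀ ⟨g, hg₀⟩
  have h1 := FormSpace.tendsto_form_zero (hn := hF₀.nonneg)
    (a := fun n => ⟨(p n).1, hp n⟩ - ⟨g, hg₀⟩) (l := atTop) (by
      simp only [map_sub]
      simpa using hlim.sub_const (FormSpace.equiv _ hF₀.nonneg ⟨g, hg₀⟩))
  have h2 := (Complex.continuous_re.tendsto 0).comp h1
  obtain ⟨n, hn⟩ := (h2.eventually (gt_mem_nhds (show (0 : ℂ).re < ε from hε))).exists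
  obtain ⟨k, hk1, hk2⟩ := S₀.mem_graph_iff.1 (mem_relInv.1 (hpH n))
  simp only at hk1 hk2
  have hk₀ : (k : E) ∈ formDomain S₀ := domain_le_formDomain hS.selfAdjoint₀ hS.nonneg₀ k.2
  have hk₁ := hS.formDomain_le hk₀
  -- The identity S₁[f - k] = S₀⁻¹[S₀k - S₁f] is expanded term by term; each representation formula
  -- produces the inner product in the opposite order, so the sides are matched up to conjugation
  -- and only real parts are compared.
  refine ⟨k, hk₁, lt_of_eq_of_lt ((congrArg Complex.re ?_).trans (Complex.conj_re _)) hn⟩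
  obtain ⟨_, hprep⟩ := hF₀.repr _ (hpH n)
  have e1 := hprep ⟨g, hg₀⟩
  have e2 := hprep ⟨(p n).1, hp n⟩
  have e3 := hF₀.nonneg.conj_form ⟨g, hg₀⟩ ⟨(p n).1, hp n⟩
  have e4 := opForm_apply hS.selfAdjoint₁ hS.nonneg₁ f hf ⟨k, hk₁⟩
  have e5 := opForm_apply hS.selfAdjoint₁ hS.nonneg₁ f hf ⟨f, hf⟩
  have e6 := hS.nonneg_form.conj_form ⟨k, hk₁⟩ ⟨f, hf⟩
  have e7 := opForm_apply hS.selfAdjoint₀ hS.nonneg₀ k hk₀ ⟨k, hk₀⟩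
  rw [hS.opForm_eq hk₀ hk₀ hk₁ hk₁, hk2] at e7
  simp only [← hk1] at e1 e2
  rw [e1, inner_conj_symm] at e3
  rw [e4, inner_conj_symm] at e6
  simp only [map_sub, LinearMap.sub_apply, e1, e2, e4, e5, ← e3, ← e6, e7, hgg, inner_conj_symm,
    ← hg]
  ring

/-- Since dom S₁ is a core of its form, the case of dom S₁ extends to D[S₁]. -/
theorem IsExtensionPair.exists_opForm_sub_lt (hS : IsExtensionPair S S₀ S₁)
    (hinv : (closedForm (relInv S₁.graph)).IsClosedRestriction (closedForm (relInv S₀.graph)))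
    (v : formDomain S₁) {ε : ℝ} (hε : 0 < ε) :
    ∃ (k : S₀.domain) (hk : (k : E) ∈ formDomain S₁),
      (opForm S₁ (v - ⟨k, hk⟩) (v - ⟨k, hk⟩)).re < ε := by
  have hF := isFormOf_closedForm_graph hS.selfAdjoint₁ hS.nonneg₁
  obtain ⟨p, hp, hpH, hlim⟩ :=
    hF.exists_tendsto (isNonnegSelfAdjoint_graph hS.selfAdjoint₁ hS.nonneg₁) v
  have h1 := FormSpace.tendsto_form_zero (hn := hF.nonneg)
    (a := fun n => v - ⟨(p n).1, hp n⟩) (l := atTop) (by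
      simp only [map_sub]
      simpa using hlim.const_sub (FormSpace.equiv _ hF.nonneg v))
  have h2 := (Complex.continuous_re.tendsto 0).comp h1
  -- The parallelogram law gives S₁[a + b] ≤ 2(S₁[a] + S₁[b]), so two errors below ε/4 suffice.
  have hε4 : (0 : ℂ).re < ε / 4 := by rw [Complex.zero_re]; positivity
  obtain ⟨n, hn⟩ := (h2.eventually (gt_mem_nhds hε4)).exists
  have hfD : (p n).1 ∈ S₁.domain := LinearPMap.mem_domain_of_mem_graph (hpH n)
  obtain ⟨k, hk, hkε⟩ := hS.exists_opForm_sub_lt_of_mem_domain hinv ⟨_, hfD⟩ (hp n)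
    (show 0 < ε / 4 by positivity)
  refine ⟨k, hk, ?_⟩
  have h3 := congrArg Complex.re (SesqForm.form_parallelogram (closedForm S₁.graph)
    (v - ⟨(p n).1, hp n⟩) (⟨(p n).1, hp n⟩ - ⟨k, hk⟩))
  have h4 := hF.nonneg.re_nonneg (v - ⟨(p n).1, hp n⟩ - (⟨(p n).1, hp n⟩ - ⟨k, hk⟩))
  rw [sub_add_sub_cancel, Complex.add_re, ← Complex.ofReal_ofNat, Complex.re_ofReal_mul,
    Complex.add_re] at h3
  simp only [Function.comp_apply] at hn
  linarith

/-! ### The infimum and the range of the square root -/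

theorem isGLB_opForm_mainTransform (hS : IsExtensionPair S S₀ S₁)
    (hΓ : IsBoundaryTriplet S S₀ S₁ Γ₀ Γ₁)
    (hinv : (closedForm (relInv S₁.graph)).IsClosedRestriction (closedForm (relInv S₀.graph)))
    (v : formDomain S₁) :
    IsGLB {r : ℝ | ∃ u : S₀.domain,
      ∃ hu : WithLp.toLp 2 ((v : E), Γ₀ v) - WithLp.toLp 2 ((u : E), (0 : K)) ∈
        formDomain (mainTransform S S₀ S₁ Γ₀ Γ₁),
      opForm (mainTransform S S₀ S₁ Γ₀ Γ₁) ⟨_, hu⟩ ⟨_, hu⟩ = (r : ℂ)} 0 := by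
  have hA := mainTransform_isSelfAdjoint hS hΓ
  have hA' := mainTransform_nonneg hS hΓ
  refine ⟨?_, fun b hb => le_of_forall_pos_lt_add fun ε hε => ?_⟩
  · rintro r ⟨u, hu, hr⟩
    have h1 := (isFormOf_closedForm_graph hA hA').nonneg ⟨_, hu⟩
    rw [hr] at h1
    exact Complex.zero_le_real.1 h1
  · obtain ⟨k, hk, hkε⟩ := hS.exists_opForm_sub_lt hinv v hε
    have hk₀ : (k : E) ∈ formDomain S₀ := domain_le_formDomain hS.selfAdjoint₀ hS.nonneg₀ k.2
    have hu : WithLp.toLp 2 ((v : E), Γ₀ v) - WithLp.toLp 2 ((k : E), (0 : K)) ∈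
        formDomain (mainTransform S S₀ S₁ Γ₀ Γ₁) := by
      refine (mem_formDomain_mainTransform hS hΓ).2 ⟨sub_mem v.2 hk, ?_⟩
      have h1 := map_sub Γ₀ v ⟨k, hk⟩
      rw [(hΓ.ker ⟨k, hk⟩).2 hk₀] at h1
      exact h1
    have h1 := opForm_mainTransform hS hΓ hu hu (sub_mem v.2 hk) (sub_mem v.2 hk)
    refine lt_of_le_of_lt (hb ⟨k, hu, ?_⟩) (by rw [zero_add]; exact hkε)
    refine h1.trans (Complex.ext rfl ?_)
    exact hS.nonneg_form.im_eq_zero _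

/-- Subtracting (u, 0) from (v, Γ₀v) does not change the pairing with (0, h), while it makes A[·]
small; hence |(h, Γ₀v)|² ≤ ‖x‖² A[y] can be pushed to zero. -/
theorem eq_zero_of_opSqrt_mainTransform_eq (hS : IsExtensionPair S S₀ S₁)
    (hΓ : IsBoundaryTriplet S S₀ S₁ Γ₀ Γ₁)
    (hinv : (closedForm (relInv S₁.graph)).IsClosedRestriction (closedForm (relInv S₀.graph)))
    {h : K} (x : (opSqrt (mainTransform S S₀ S₁ Γ₀ Γ₁)).domain)
    (hx : opSqrt (mainTransform S S₀ S₁ Γ₀ Γ₁) x = WithLp.toLp 2 ((0 : E), h)) : h = 0 := by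
  have hA := mainTransform_isSelfAdjoint hS hΓ
  have hA' := mainTransform_nonneg hS hΓ
  have hdom := opSqrt_domain hA hA'
  have hsym := isFormalAdjoint_self (opSqrt_spec hA hA').selfAdjoint
  refine ext_inner_right ℂ fun k => ?_
  obtain ⟨v, rfl⟩ := hΓ.surjective k
  rw [inner_zero_left, ← norm_eq_zero, ← sq_eq_zero_iff]
  refine le_antisymm (le_of_forall_pos_le_add fun ε hε => ?_) (sq_nonneg _)
  -- The added 1 keeps the divisor of ε positive when x = 0.
  have hc : 0 < ‖(x : WithLp 2 (E × K))‖ ^ 2 + 1 := by positivity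
  obtain ⟨r, ⟨u, hu, hr⟩, -, hrε⟩ := (isGLB_opForm_mainTransform hS hΓ hinv v).exists_between
    (div_pos hε hc)
  set y := WithLp.toLp 2 ((v : E), Γ₀ v) - WithLp.toLp 2 ((u : E), (0 : K)) with hy
  have hyd : y ∈ (opSqrt (mainTransform S S₀ S₁ Γ₀ Γ₁)).domain := hdom ▸ hu
  have h1 := hsym x ⟨y, hyd⟩
  have h2 : inner ℂ (WithLp.toLp 2 ((0 : E), h)) y = inner ℂ h (Γ₀ v) := by
    rw [WithLp.prod_inner_apply, hy]
    simp
  rw [hx] at h1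
  simp only [h2] at h1
  have h3 := opForm_eq_inner_opSqrt hA hA' ⟨y, hu⟩ ⟨y, hu⟩ hyd hyd
  rw [hr, inner_self_eq_norm_sq_to_K] at h3
  have h4 : r = ‖opSqrt (mainTransform S S₀ S₁ Γ₀ Γ₁) ⟨y, hyd⟩‖ ^ 2 := Complex.ofReal_injective (h3.trans (by push_cast; rfl))
  rw [h1, zero_add]
  calc _ ≤ (‖(x : WithLp 2 (E × K))‖ * ‖opSqrt (mainTransform S S₀ S₁ Γ₀ Γ₁) ⟨y, hyd⟩‖) ^ 2 :=
        pow_le_pow_left₀ (norm_nonneg _) (norm_inner_le_norm _ _) 2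
    _ = ‖(x : WithLp 2 (E × K))‖ ^ 2 * r := by rw [mul_pow, h4]
    _ ≤ (‖(x : WithLp 2 (E × K))‖ ^ 2 + 1) * (ε / (‖(x : WithLp 2 (E × K))‖ ^ 2 + 1)) := by
        refine mul_le_mul (by linarith) hrε.le ?_ hc.le
        rw [h4]; exact sq_nonneg _
    _ = ε := mul_div_cancel₀ _ hc.ne'

end MainTransform
end NonnegExt
end

/-! ### The theorem -/

theorem theorem7 {E K : Type*}
    [NormedAddCommGroup E] [InnerProductSpace ℂ E] [CompleteSpace E]
    [NormedAddCommGroup K] [InnerProductSpace ℂ K] [CompleteSpace K]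
    (S S₀ S₁ : E →ₗ.[ℂ] E) (hS : NonnegExt.IsExtensionPair S S₀ S₁)
    (Γ₀ : NonnegExt.formDomain S₁ →ₗ[ℂ] K) (Γ₁ : NonnegExt.boundaryDomain S₀ S₁ →ₗ[ℂ] K)
    (hΓ : NonnegExt.IsBoundaryTriplet S S₀ S₁ Γ₀ Γ₁)
    (A : WithLp 2 (E × K) →ₗ.[ℂ] WithLp 2 (E × K))
    (hA : A = NonnegExt.mainTransform S S₀ S₁ Γ₀ Γ₁) :
    -- `L ⊆ D[S₁] ∩ dom S*`, so that `A` is defined exactly on the pairs `(u, Γ₀ u)`, `u ∈ L`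
    (NonnegExt.boundaryDomain S₀ S₁ ≤ NonnegExt.formDomain S₁ ⊓ S†.domain) ∧
    -- `A` is a nonnegative selfadjoint extension of `S`
    IsSelfAdjoint A ∧ NonnegExt.IsNonneg A ∧
    (∀ u : S.domain, ∃ hu : WithLp.toLp 2 ((u : E), (0 : K)) ∈ A.domain,
      A ⟨_, hu⟩ = WithLp.toLp 2 (S u, 0)) ∧
    -- the closed form of `A`
    (∀ x : WithLp 2 (E × K), x ∈ NonnegExt.formDomain A ↔
      ∃ v : NonnegExt.formDomain S₁, x = WithLp.toLp 2 ((v : E), Γ₀ v)) ∧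
    (∀ (u v : NonnegExt.formDomain S₁)
      (hu : WithLp.toLp 2 ((u : E), Γ₀ u) ∈ NonnegExt.formDomain A)
      (hv : WithLp.toLp 2 ((v : E), Γ₀ v) ∈ NonnegExt.formDomain A),
      NonnegExt.opForm A ⟨_, hu⟩ ⟨_, hv⟩ = NonnegExt.opForm S₁ u v) ∧
    -- `dom A^{1/2} ∩ K = {0}`
    (∀ h : K, WithLp.toLp 2 ((0 : E), h) ∈ (NonnegExt.opSqrt A).domain → h = 0) ∧
    -- the additional assertions
    (NonnegExt.IsSpecialPair S S₀ S₁ →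
      (∀ v : NonnegExt.formDomain S₁,
        IsGLB {r : ℝ | ∃ u : S₀.domain,
          ∃ hu : WithLp.toLp 2 ((v : E), Γ₀ v) - WithLp.toLp 2 ((u : E), (0 : K)) ∈
            NonnegExt.formDomain A,
          NonnegExt.opForm A ⟨_, hu⟩ ⟨_, hu⟩ = (r : ℂ)} 0) ∧
      (∀ h : K, (∃ x : (NonnegExt.opSqrt A).domain,
        NonnegExt.opSqrt A x = WithLp.toLp 2 ((0 : E), h)) → h = 0)) := by
  subst hA
  have hsa := NonnegExt.mainTransform_isSelfAdjoint hS hΓ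
  have hnn := NonnegExt.mainTransform_nonneg hS hΓ
  refine ⟨hS.boundaryDomain_le, hsa, hnn, NonnegExt.mainTransform_extends hS hΓ, fun x => ?_,
    fun u v hu hv => NonnegExt.opForm_mainTransform hS hΓ hu hv u.2 v.2, fun h hh => ?_,
    fun hsp => ⟨NonnegExt.isGLB_opForm_mainTransform hS hΓ hsp.inv_form_restriction,
      fun h ⟨x, hx⟩ =>
        NonnegExt.eq_zero_of_opSqrt_mainTransform_eq hS hΓ hsp.inv_form_restriction x hx⟩⟩
  · rw [NonnegExt.mem_formDomain_mainTransform hS hΓ]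
    constructor
    · rintro ⟨hD, hx⟩
      exact ⟨⟨x.fst, hD⟩, WithLp.ofLp_injective 2 (Prod.ext rfl hx.symm)⟩
    · rintro ⟨v, rfl⟩
      exact ⟨v.2, rfl⟩
  · rw [NonnegExt.opSqrt_domain hsa hnn, NonnegExt.mem_formDomain_mainTransform hS hΓ] at hh
    obtain ⟨hD, hh⟩ := hh
    exact hh.symm.trans (map_zero Γ₀)
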